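/- Let $N\ge 3$, $2^*=\frac{2N}{N-2}$ and $\Lambda_N=\left(\frac{N-2}{2}\right)^2$. Let $D^{1,2}(\mathbb R^N)$ be the completion of $C_c^\infty(\mathbb R^N)$ in the norm $\|u\|=\left(\int_{\mathbb R^N}|\nabla u|^2\,dx\right)^{1/2}$, regarded as a space of functions in $L^{2^*}(\mathbb R^N)$. Let $m:\mathbb R^N\to\mathbb R$ be continuous, assume that the limit $m(\infty)=\lim_{|x|\to\infty}m(x)$ exists in $\mathbb R$, and that $m(0)>0$ and $m(\infty)>0$. Put $$\Lambda_m=\inf\left\{\int_{\mathbb R^N}|\nabla u|^2\,dx \;:\; u\in D^{1,2}(\mathbb R^N),\ \int_{\mathbb R^N}\frac{m(x)}{|x|^2}u^2\,dx=1\right\},$$ and suppose that $$\Lambda_m<\Lambda_N\,\min\left(\frac1{m(0)},\frac1{m(\infty)}\right).$$ Let $\phi_1\in D^{1,2}(\mathbb R^N)$ be a positive ground state (principal eigenfunction), that is, $\phi_1>0$ a.e., $\int_{\mathbb R^N}\frac{m(x)}{|x|^2}\phi_1^2\,dx>0$ and $$\int_{\mathbb R^N}|\nabla\phi_1|^2\,dx=\Lambda_m\int_{\mathbb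 R^N}\frac{m(x)}{|x|^2}\phi_1^2\,dx .$$ Then there exist $\delta>0$ and $r>0$ such that $\phi_1\in L^{2^*(1+\delta)}(B(0,r))$. -/

import Mathlib

open MeasureTheory Filter Topology
open scoped ContDiff

/-- The critical Sobolev exponent `2* = 2N / (N - 2)` (used for `N ≥ 3`). -/
noncomputable def sobolevExp (N : ℕ) : ℝ := 2 * (N : ℝ) / ((N : ℝ) - 2)

/-- The Hardy constant `Λ_N = ((N - 2) / 2) ^ 2`. -/
noncomputable def hardyConst (N : ℕ) : ℝ := (((N : ℝ) - 2) / 2) ^ 2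

/-- `u` belongs to `D^{1,2}(ℝ^N)`, the completion of `C_c^∞(ℝ^N)` in the norm `‖∇u‖_{L²}`, and `G`
is its gradient. By the Sobolev inequality the completion is realised as a space of (classes of)
functions in `L^{2*}`: `u` is the `L^{2*}`-limit of test functions whose gradients converge to `G`
in `L²`. -/
structure HasD12Gradient {N : ℕ} (u : EuclideanSpace ℝ (Fin N) → ℝ)
    (G : EuclideanSpace ℝ (Fin N) → EuclideanSpace ℝ (Fin N)) : Prop where
  memLp : MemLp u (ENNReal.ofReal (sobolevExp N)) volume
  memLp_grad : MemLp G 2 volume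
  exists_approx : ∃ f : ℕ → EuclideanSpace ℝ (Fin N) → ℝ,
    (∀ k, ContDiff ℝ ∞ (f k) ∧ HasCompactSupport (f k)) ∧
    Tendsto (fun k => eLpNorm (fun x => f k x - u x) (ENNReal.ofReal (sobolevExp N)) volume)
      atTop (𝓝 0) ∧
    Tendsto (fun k => eLpNorm (fun x => gradient (f k) x - G x) 2 volume) atTop (𝓝 0)

/-- The weighted potential term `∫ (m(x) / |x|²) u² dx`. -/
noncomputable def hardyTerm {N : ℕ} (m u : EuclideanSpace ℝ (Fin N) → ℝ) : ℝ :=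
  ∫ x, m x / ‖x‖ ^ 2 * u x ^ 2

/-- `Λ_m = inf { ∫ |∇u|² dx : u ∈ D^{1,2}(ℝ^N), ∫ (m(x) / |x|²) u² dx = 1 }`. -/
noncomputable def principalEigenvalue {N : ℕ} (m : EuclideanSpace ℝ (Fin N) → ℝ) : ℝ :=
  sInf {t : ℝ | ∃ u G, HasD12Gradient u G ∧ hardyTerm m u = 1 ∧ t = ∫ x, ‖G x‖ ^ 2}

/-- `φ ∈ D^{1,2}(ℝ^N)` is a ground state of finite energy (a minimizer for `Λ_m`, not necessarily
normalised): `∫ (m(x) / |x|²) φ² dx > 0` and the Rayleigh quotient of `φ` equals `Λ_m`. -/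
def IsGroundState {N : ℕ} (m φ : EuclideanSpace ℝ (Fin N) → ℝ) : Prop :=
  ∃ G, HasD12Gradient φ G ∧ 0 < hardyTerm m φ ∧
    (∫ x, ‖G x‖ ^ 2) / hardyTerm m φ = principalEigenvalue m

/-!
The ground state `φ` minimizes the quotient of `∫ |∇u|²` and `∫ (m / |x|²) u²`, so the energy form
`Q(u, v) = ∫ ∇u · ∇v - Λ_m ∫ (m / |x|²) u v` is positive semidefinite on `C_c^∞` and vanishes at
`φ`. Near the origin `Λ_m m(x) ≤ κ Λ_N` with some `κ < 1`, because `Λ_m m(0) < Λ_N`. This leaves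
room in the Hardy inequality to test the Euler–Lagrange equation with `ψ = η² φ g(φ)²`, where `η` is
a cutoff near the origin and `g(t)` is a truncation of `(1 + t²) ^ (s / 2)` with `s > 0` small.
With `w = η φ g(φ)` one has `φ ψ = w²` and, pointwise,
`(1 - 4 s²) |∇w|² ≤ ∇φ · ∇ψ + 6 φ² g(φ)² |∇η|²` (`norm_gradient_powerCutoff_sq_le`). The potential
term is at most `κ ∫ |∇w|²` by the sharp Hardy inequality `hardy_inequality`, hence `∫ |∇w|²` is
controlled by `∫ φ² g(φ)² |∇η|²` (`caccioppoli_powerCutoff`), which is bounded uniformly in the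
truncation as soon as `2 + 2 s ≤ 2*`. The Sobolev inequality bounds `w` in `L^{2*}`; removing the
truncation gives `|φ| ^ (1 + s) ∈ L^{2*}` near the origin, and `δ = s`.

No calculus for weakly differentiable functions is needed: all nonlinear manipulations are made on
test functions `f k → φ`, which satisfy the Euler–Lagrange equation asymptotically, since
`Q(f k, ψ k)² ≤ Q(f k, f k) Q(ψ k, ψ k)` (`energyForm_sq_le`), the first factor tends to
`Q(φ, φ) = 0` (`tendsto_energyForm_self`), and the second is bounded. The passage to the limit is
made in `eLpNorm_powerCutoff_le`.
-/

/-! ### Real integrals -/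

theorem integral_add_const_mul_add_const_mul {α : Type*} [MeasurableSpace α] {μ : Measure α}
    {f g h : α → ℝ} (hf : Integrable f μ) (hg : Integrable g μ) (hh : Integrable h μ) (a b : ℝ) :
    ∫ x, (f x + a * g x + b * h x) ∂μ
      = ∫ x, f x ∂μ + a * ∫ x, g x ∂μ + b * ∫ x, h x ∂μ := by
  have hfg : Integrable (fun x => f x + a * g x) μ := hf.add (hg.const_mul a)
  rw [integral_add hfg (hh.const_mul b), integral_add hf (hg.const_mul a),
    integral_const_mul, integral_const_mul]

/-- Fatou's lemma for a sequence of nonnegative integrable functions. -/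
theorem integrable_and_integral_le_of_tendsto_ae {α : Type*} [MeasurableSpace α] {μ : Measure α}
    {F : ℕ → α → ℝ} {f : α → ℝ} {c : ℕ → ℝ} {C : ℝ} (hF : ∀ n, Integrable (F n) μ)
    (h0 : ∀ n x, 0 ≤ F n x) (hc : ∀ n, ∫ x, F n x ∂μ ≤ c n) (hC : Tendsto c atTop (𝓝 C))
    (hlim : ∀ᵐ x ∂μ, Tendsto (fun n => F n x) atTop (𝓝 (f x))) :
    Integrable f μ ∧ ∫ x, f x ∂μ ≤ C := by
  have hC0 : 0 ≤ C := ge_of_tendsto' hC fun n => (integral_nonneg (h0 n)).trans (hc n)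
  have hmeas : AEStronglyMeasurable f μ :=
    aestronglyMeasurable_of_tendsto_ae atTop (fun n => (hF n).aestronglyMeasurable) hlim
  have hf0 : 0 ≤ᵐ[μ] f := hlim.mono fun x hx => ge_of_tendsto' hx fun n => h0 n x
  have hle : ∫⁻ x, ENNReal.ofReal (f x) ∂μ ≤ ENNReal.ofReal C := by
    calc ∫⁻ x, ENNReal.ofReal (f x) ∂μ
        = ∫⁻ x, liminf (fun n => ENNReal.ofReal (F n x)) atTop ∂μ :=
          lintegral_congr_ae (hlim.mono fun x hx =>
            ((ENNReal.continuous_ofReal.tendsto _).comp hx).liminf_eq.symm)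
      _ ≤ liminf (fun n => ∫⁻ x, ENNReal.ofReal (F n x) ∂μ) atTop :=
          lintegral_liminf_le' fun n => (hF n).aemeasurable.ennreal_ofReal
      _ ≤ liminf (fun n => ENNReal.ofReal (c n)) atTop := by
          refine liminf_le_liminf (Eventually.of_forall fun n => ?_)
          rw [← ofReal_integral_eq_lintegral_ofReal (hF n) (ae_of_all _ (h0 n))]
          exact ENNReal.ofReal_le_ofReal (hc n)
      _ = ENNReal.ofReal C := ((ENNReal.continuous_ofReal.tendsto _).comp hC).liminf_eq
  refine ⟨⟨hmeas, ?_⟩, ?_⟩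
  · rw [hasFiniteIntegral_iff_ofReal hf0]
    exact hle.trans_lt ENNReal.ofReal_lt_top
  · rw [integral_eq_lintegral_of_nonneg_ae hf0 hmeas]
    exact ENNReal.toReal_le_of_le_ofReal hC0 hle

/-- Quadratic functionals with a bounded weight are continuous along `L²`-convergent sequences. -/
theorem tendsto_integral_mul_norm_sq {α V : Type*} [MeasurableSpace α] {μ : Measure α}
    [NormedAddCommGroup V] {w : α → ℝ} {B : ℝ} (hw : AEStronglyMeasurable w μ)
    (hB0 : 0 ≤ B) (hB : ∀ x, |w x| ≤ B) {v : ℕ → α → V} {u : α → V} (hv : ∀ k, MemLp (v k) 2 μ)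
    (hu : MemLp u 2 μ) (hlim : Tendsto (fun k => ∫ x, ‖v k x - u x‖ ^ 2 ∂μ) atTop (𝓝 0)) :
    Tendsto (fun k => ∫ x, w x * ‖v k x‖ ^ 2 ∂μ) atTop (𝓝 (∫ x, w x * ‖u x‖ ^ 2 ∂μ)) := by
  have hi : ∀ {z : α → V}, MemLp z 2 μ → Integrable (fun x => ‖z x‖ ^ 2) μ := fun hz => by
    simpa using hz.integrable_norm_pow (p := 2) two_ne_zero
  have hiw : ∀ {z : α → V}, MemLp z 2 μ → Integrable (fun x => w x * ‖z x‖ ^ 2) μ := fun hz =>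
    (hi hz).bdd_mul hw (ae_of_all _ hB)
  set d : ℕ → ℝ := fun k => ∫ x, ‖v k x - u x‖ ^ 2 ∂μ with hd
  have hd0 : ∀ k, 0 ≤ d k := fun k => integral_nonneg fun x => by positivity
  set A := ∫ x, ‖u x‖ ^ 2 ∂μ with hA
  set a : ℕ → ℝ := fun k => √(d k) + 1 / ((k : ℝ) + 1) with ha
  have ha0 : ∀ k, 0 < a k := fun k => by simp only [ha]; positivity
  -- `2 ‖v‖ ‖v_k - v‖ ≤ a_k ‖v‖² + a_k⁻¹ ‖v_k - v‖²`, where `a_k → 0` but `d_k / a_k → 0`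
  have hbound : ∀ k, |∫ x, w x * ‖v k x‖ ^ 2 ∂μ - ∫ x, w x * ‖u x‖ ^ 2 ∂μ|
      ≤ B * (d k + √(d k) + a k * A) := fun k => by
    rw [← integral_sub (hiw (hv k)) (hiw hu)]
    have hik := hi ((hv k).sub hu)
    simp only [Pi.sub_apply] at hik
    calc |∫ x, (w x * ‖v k x‖ ^ 2 - w x * ‖u x‖ ^ 2) ∂μ|
        ≤ ∫ x, |w x * ‖v k x‖ ^ 2 - w x * ‖u x‖ ^ 2| ∂μ := abs_integral_le_integral_abs
      _ ≤ ∫ x, B * (‖v k x - u x‖ ^ 2 + (a k)⁻¹ * ‖v k x - u x‖ ^ 2 + a k * ‖u x‖ ^ 2) ∂μ := by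
          refine integral_mono ((hiw (hv k)).sub (hiw hu)).abs
            ((((hik).add (hik.const_mul _)).add ((hi hu).const_mul _)).const_mul B) fun x => ?_
          simp only
          rw [← mul_sub, abs_mul]
          refine mul_le_mul (hB x) ?_ (abs_nonneg _) hB0
          have h1 : |‖v k x‖ - ‖u x‖| ≤ ‖v k x - u x‖ := abs_norm_sub_norm_le _ _
          have h2 : ‖v k x‖ ^ 2 - ‖u x‖ ^ 2 = (‖v k x‖ - ‖u x‖) * (‖v k x‖ - ‖u x‖ + 2 * ‖u x‖) := by
            ring
          have h3 : |‖v k x‖ - ‖u x‖ + 2 * ‖u x‖| ≤ ‖v k x - u x‖ + 2 * ‖u x‖ :=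
            (abs_add_le _ _).trans (add_le_add h1 (abs_of_nonneg (by positivity)).le)
          rw [h2, abs_mul]
          refine (mul_le_mul h1 h3 (abs_nonneg _) (norm_nonneg _)).trans ?_
          have h4 : 0 ≤ (a k)⁻¹ * (‖v k x - u x‖ - a k * ‖u x‖) ^ 2 := by
            have := ha0 k
            positivity
          have h5 : (a k)⁻¹ * (‖v k x - u x‖ - a k * ‖u x‖) ^ 2 = (a k)⁻¹ * ‖v k x - u x‖ ^ 2
              - 2 * ‖v k x - u x‖ * ‖u x‖ + a k * ‖u x‖ ^ 2 := by
            have := (ha0 k).ne'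
            field_simp
            ring
          linarith
      _ = B * (d k + (a k)⁻¹ * d k + a k * A) := by
          rw [integral_const_mul, integral_add_const_mul_add_const_mul hik hik (hi hu)]
      _ ≤ B * (d k + √(d k) + a k * A) := by
          have : (a k)⁻¹ * d k ≤ √(d k) := by
            rw [inv_mul_le_iff₀ (ha0 k)]
            calc d k = √(d k) * √(d k) := (Real.mul_self_sqrt (hd0 k)).symm
              _ ≤ a k * √(d k) := by
                refine mul_le_mul_of_nonneg_right ?_ (Real.sqrt_nonneg _)
                simp only [ha]
                have : (0 : ℝ) ≤ 1 / ((k : ℝ) + 1) := by positivity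
                linarith
          gcongr
  have hsq : Tendsto (fun k => √(d k)) atTop (𝓝 0) := by
    simpa [Function.comp_def] using (Real.continuous_sqrt.tendsto 0).comp hlim
  have hat : Tendsto a atTop (𝓝 0) := by
    simpa [ha] using hsq.add (tendsto_one_div_add_atTop_nhds_zero_nat (𝕜 := ℝ))
  have hz : Tendsto (fun k => B * (d k + √(d k) + a k * A)) atTop (𝓝 0) := by
    simpa using ((hlim.add hsq).add (hat.mul_const A)).const_mul B
  exact tendsto_iff_norm_sub_tendsto_zero.2 (squeeze_zero (fun k => norm_nonneg _) hbound hz)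

/-! ### Gradients of products and compositions -/

theorem HasGradientAt.fun_mul {E : Type*} [NormedAddCommGroup E] [InnerProductSpace ℝ E]
    [CompleteSpace E] {f g : E → ℝ} {f' g' x : E} (hf : HasGradientAt f f' x)
    (hg : HasGradientAt g g' x) :
    HasGradientAt (fun y => f y * g y) (f x • g' + g x • f') x := by
  rw [hasGradientAt_iff_hasFDerivAt] at *
  exact (hf.mul hg).congr_fderiv (by ext; simp)

theorem HasDerivAt.comp_hasGradientAt {E : Type*} [NormedAddCommGroup E] [InnerProductSpace ℝ E]
    [CompleteSpace E] {F : ℝ → ℝ} {F' : ℝ} {f : E → ℝ} {f' x : E}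
    (hF : HasDerivAt F F' (f x)) (hf : HasGradientAt f f' x) :
    HasGradientAt (fun y => F (f y)) (F' • f') x := by
  rw [hasGradientAt_iff_hasFDerivAt] at *
  exact (hF.comp_hasFDerivAt x hf).congr_fderiv (by ext; simp)

theorem HasGradientAt.fun_add_const_mul {E : Type*} [NormedAddCommGroup E]
    [InnerProductSpace ℝ E] [CompleteSpace E] {f g : E → ℝ} {f' g' x : E}
    (hf : HasGradientAt f f' x) (hg : HasGradientAt g g' x) (t : ℝ) :
    HasGradientAt (fun y => f y + t * g y) (f' + t • g') x := by
  rw [hasGradientAt_iff_hasFDerivAt] at *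
  exact (hf.add (hg.const_mul t)).congr_fderiv (by ext; simp)

/-! ### Test functions -/

/-- The class `C_c^∞(ℝ^N)`. -/
def IsTestFunction {N : ℕ} (f : EuclideanSpace ℝ (Fin N) → ℝ) : Prop :=
  ContDiff ℝ ∞ f ∧ HasCompactSupport f

namespace IsTestFunction

variable {N : ℕ} {f g : EuclideanSpace ℝ (Fin N) → ℝ}

theorem continuous (hf : IsTestFunction f) : Continuous f := hf.1.continuous

theorem contDiff_one (hf : IsTestFunction f) : ContDiff ℝ 1 f :=
  hf.1.of_le (by exact_mod_cast le_top)

theorem hasGradientAt (hf : IsTestFunction f) (x : EuclideanSpace ℝ (Fin N)) :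
    HasGradientAt f (gradient f x) x :=
  (hf.contDiff_one.differentiable (by simp) x).hasGradientAt

theorem continuous_gradient (hf : IsTestFunction f) : Continuous (gradient f) :=
  (LinearIsometryEquiv.continuous _).comp (hf.contDiff_one.continuous_fderiv (by simp))

theorem hasCompactSupport_gradient (hf : IsTestFunction f) : HasCompactSupport (gradient f) :=
  (hf.2.fderiv (𝕜 := ℝ)).comp_left (g := (InnerProductSpace.toDual ℝ _).symm) (map_zero _)

theorem mul_left (hf : IsTestFunction f) (hg : ContDiff ℝ ∞ g) :
    IsTestFunction (fun x => f x * g x) :=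
  ⟨hf.1.mul hg, hf.2.mul_right⟩

theorem add_const_mul (hf : IsTestFunction f) (hg : IsTestFunction g) (t : ℝ) :
    IsTestFunction (fun x => f x + t * g x) :=
  ⟨hf.1.add (contDiff_const.mul hg.1), hf.2.add hg.2.mul_left⟩

theorem gradient_add_const_mul (hf : IsTestFunction f) (hg : IsTestFunction g) (t : ℝ)
    (x : EuclideanSpace ℝ (Fin N)) :
    gradient (fun y => f y + t * g y) x = gradient f x + t • gradient g x :=
  ((hf.hasGradientAt x).fun_add_const_mul (hg.hasGradientAt x) t).gradient

theorem integrable_inner_gradient (hf : IsTestFunction f) (hg : IsTestFunction g) :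
    Integrable (fun x => inner ℝ (gradient f x) (gradient g x)) := by
  refine (hf.continuous_gradient.inner hg.continuous_gradient).integrable_of_hasCompactSupport
    (hf.hasCompactSupport_gradient.mono fun x hx => ?_)
  contrapose! hx
  simp [Function.notMem_support.1 hx]

theorem integrable_norm_gradient_sq (hf : IsTestFunction f) :
    Integrable (fun x => ‖gradient f x‖ ^ 2) :=
  (hf.integrable_inner_gradient hf).congr
    (ae_of_all _ fun x => real_inner_self_eq_norm_sq (gradient f x))

theorem memLp (hf : IsTestFunction f) (p : ENNReal) : MemLp f p volume :=
  hf.continuous.memLp_of_hasCompactSupport hf.2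

theorem memLp_gradient (hf : IsTestFunction f) (p : ENNReal) : MemLp (gradient f) p volume :=
  hf.continuous_gradient.memLp_of_hasCompactSupport hf.hasCompactSupport_gradient

end IsTestFunction

/-! ### The Hardy inequality with the sharp constant -/

theorem ae_ne_zero_of_pos {N : ℕ} (hN : 0 < N) : ∀ᵐ x : EuclideanSpace ℝ (Fin N), x ≠ 0 := by
  have : Nonempty (Fin N) := ⟨⟨0, hN⟩⟩
  exact Measure.ae_ne volume 0

/-- The divergence theorem for the field `x / (|x|² + ε)`, whose divergence is at least
`(N - 2) / (|x|² + ε)`. -/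
theorem integral_div_le_neg_integral_inner_gradient {N : ℕ}
    {u : EuclideanSpace ℝ (Fin N) → ℝ} (hu : IsTestFunction u) (hu0 : ∀ x, 0 ≤ u x) {ε : ℝ}
    (hε : 0 < ε) :
    ((N : ℝ) - 2) * ∫ x, u x / (‖x‖ ^ 2 + ε) ≤
      -∫ x, inner ℝ (gradient u x) x / (‖x‖ ^ 2 + ε) := by
  have hq : ∀ x : EuclideanSpace ℝ (Fin N), 0 < ‖x‖ ^ 2 + ε := fun x => by positivity
  have hqc : Continuous fun x : EuclideanSpace ℝ (Fin N) => ‖x‖ ^ 2 + ε := by fun_prop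
  have hqF : ∀ x : EuclideanSpace ℝ (Fin N),
      HasFDerivAt (fun x => ‖x‖ ^ 2 + ε) (2 • innerSL ℝ x) x := fun x =>
    ((hasStrictFDerivAt_norm_sq x).hasFDerivAt).add_const ε
  set X : Fin N → EuclideanSpace ℝ (Fin N) → ℝ := fun i x => x i / (‖x‖ ^ 2 + ε) with hX
  set e : Fin N → EuclideanSpace ℝ (Fin N) := fun i => EuclideanSpace.single i 1 with he
  have hpr : ∀ (i : Fin N) (x : EuclideanSpace ℝ (Fin N)),
      HasFDerivAt (fun x : EuclideanSpace ℝ (Fin N) => x i) (EuclideanSpace.proj (𝕜 := ℝ) i) x :=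
    fun i x => (EuclideanSpace.proj (𝕜 := ℝ) i).hasFDerivAt
  have hXd : ∀ i x, HasFDerivAt (X i) _ x := fun i x =>
    (hpr i x).mul ((hasDerivAt_inv (hq x).ne').comp_hasFDerivAt x (hqF x))
  have hXe : ∀ i x, fderiv ℝ (X i) x (e i)
      = 1 / (‖x‖ ^ 2 + ε) - 2 * (x i) ^ 2 / (‖x‖ ^ 2 + ε) ^ 2 := fun i x => by
    rw [(hXd i x).fderiv]
    have := (hq x).ne'
    simp [he, EuclideanSpace.inner_single_right]
    field_simp
    ring
  have hXc : ∀ i, Continuous (X i) := fun i => by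
    refine Continuous.div (by fun_prop) hqc fun x => (hq x).ne'
  have hXec : ∀ i, Continuous fun x => fderiv ℝ (X i) x (e i) := fun i => by
    simp only [hXe]
    refine Continuous.sub ?_ ?_
    · exact continuous_const.div hqc fun x => (hq x).ne'
    · exact Continuous.div (by fun_prop) (hqc.pow 2) fun x => (pow_pos (hq x) 2).ne'
  have hint : ∀ {F : EuclideanSpace ℝ (Fin N) → ℝ}, Continuous F →
      Integrable (fun x => u x * F x) := fun hF =>
    (hu.continuous.mul hF).integrable_of_hasCompactSupport hu.2.mul_right
  have hdu : ∀ i x, fderiv ℝ u x (e i) = gradient u x i := fun i x => by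
    rw [← inner_gradient_left (𝕜 := ℝ), he, EuclideanSpace.inner_single_right]
    simp
  have hint' : ∀ i, Integrable (fun x => fderiv ℝ u x (e i) * X i x) := fun i => by
    simp only [hdu]
    refine Continuous.integrable_of_hasCompactSupport (Continuous.mul ?_ (hXc i)) ?_
    · exact (EuclideanSpace.proj (𝕜 := ℝ) i).continuous.comp hu.continuous_gradient
    · exact HasCompactSupport.mul_right (hu.hasCompactSupport_gradient.comp_left
        (g := fun v : EuclideanSpace ℝ (Fin N) => v i) rfl)
  have hibp : ∀ i, ∫ x, u x * fderiv ℝ (X i) x (e i) = -∫ x, fderiv ℝ u x (e i) * X i x :=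
    fun i => integral_mul_fderiv_eq_neg_fderiv_mul_of_integrable (hint' i) (hint (hXec i))
      (hint (hXc i)) (fun x _ => hu.contDiff_one.differentiable (by simp) x)
      (fun x _ => (hXd i x).differentiableAt)
  have hsum : ∫ x, u x * ∑ i, fderiv ℝ (X i) x (e i)
      = -∫ x, inner ℝ (gradient u x) x / (‖x‖ ^ 2 + ε) := by
    calc ∫ x, u x * ∑ i, fderiv ℝ (X i) x (e i)
        = ∫ x, ∑ i, u x * fderiv ℝ (X i) x (e i) := by simp only [Finset.mul_sum]
      _ = ∑ i, ∫ x, u x * fderiv ℝ (X i) x (e i) :=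
          integral_finsetSum _ fun i _ => hint (hXec i)
      _ = -∑ i, ∫ x, fderiv ℝ u x (e i) * X i x := by
          simp only [hibp, Finset.sum_neg_distrib]
      _ = -∫ x, ∑ i, fderiv ℝ u x (e i) * X i x := by
          rw [integral_finsetSum _ fun i _ => hint' i]
      _ = _ := by
          congr 1
          refine integral_congr_ae (ae_of_all _ fun x => ?_)
          simp only [hdu, hX, PiLp.inner_apply, Finset.sum_div]
          refine Finset.sum_congr rfl fun i _ => ?_
          simp
          ring
  rw [← hsum, ← integral_const_mul]
  refine integral_mono ?_ (hint (continuous_finsetSum _ fun i _ => hXec i)) fun x => ?_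
  · refine (hint (F := fun x => ((N : ℝ) - 2) / (‖x‖ ^ 2 + ε))
      (continuous_const.div hqc fun x => (hq x).ne')).congr (ae_of_all _ fun x => ?_)
    simp only
    ring
  · have hs : ∑ i, fderiv ℝ (X i) x (e i)
        = N / (‖x‖ ^ 2 + ε) - 2 * ‖x‖ ^ 2 / (‖x‖ ^ 2 + ε) ^ 2 := by
      simp only [hXe, Finset.sum_sub_distrib, ← Finset.sum_div, ← Finset.mul_sum]
      rw [EuclideanSpace.real_norm_sq_eq]
      simp
    simp only [hs]
    have hle : ((N : ℝ) - 2) / (‖x‖ ^ 2 + ε)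
        ≤ N / (‖x‖ ^ 2 + ε) - 2 * ‖x‖ ^ 2 / (‖x‖ ^ 2 + ε) ^ 2 := by
      have h1 : ‖x‖ ^ 2 / (‖x‖ ^ 2 + ε) ^ 2 ≤ 1 / (‖x‖ ^ 2 + ε) := by
        rw [div_le_div_iff₀ (pow_pos (hq x) 2) (hq x)]
        nlinarith [hq x]
      rw [sub_div, mul_div_assoc 2 (‖x‖ ^ 2), ← mul_one_div (2 : ℝ)]
      linarith
    calc ((N : ℝ) - 2) * (u x / (‖x‖ ^ 2 + ε)) = u x * (((N : ℝ) - 2) / (‖x‖ ^ 2 + ε)) := by ring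
      _ ≤ _ := mul_le_mul_of_nonneg_left hle (hu0 x)

/-- The Hardy inequality with the regularized potential `1 / (|x|² + ε)`, which avoids the
singularity at the origin in the integration by parts. -/
theorem hardy_regularized {N : ℕ} (hN : 2 ≤ N) {f : EuclideanSpace ℝ (Fin N) → ℝ}
    (hf : IsTestFunction f) {ε : ℝ} (hε : 0 < ε) :
    hardyConst N * ∫ x, f x ^ 2 / (‖x‖ ^ 2 + ε) ≤ ∫ x, ‖gradient f x‖ ^ 2 := by
  have hq : ∀ x : EuclideanSpace ℝ (Fin N), 0 < ‖x‖ ^ 2 + ε := fun x => by positivity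
  have hqc : Continuous fun x : EuclideanSpace ℝ (Fin N) => ‖x‖ ^ 2 + ε := by fun_prop
  have hc : 0 ≤ (N : ℝ) - 2 := by
    have : (2 : ℝ) ≤ N := by exact_mod_cast hN
    linarith
  have hff : IsTestFunction (fun x => f x * f x) := hf.mul_left hf.1
  have hgr : ∀ x, gradient (fun x => f x * f x) x = (2 * f x) • gradient f x := fun x => by
    rw [((hf.hasGradientAt x).fun_mul (hf.hasGradientAt x)).gradient, ← add_smul, two_mul]
  have hdiv := integral_div_le_neg_integral_inner_gradient hff (fun x => mul_self_nonneg _) hε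
  simp only [hgr, inner_smul_left, conj_trivial] at hdiv
  simp only [← sq] at hdiv
  have hi1 : Integrable (fun x => f x ^ 2 / (‖x‖ ^ 2 + ε)) := by
    refine ((hf.continuous.pow 2).div hqc fun x => (hq x).ne').integrable_of_hasCompactSupport ?_
    refine hf.2.mono fun x hx => ?_
    contrapose! hx
    simp [Function.notMem_support.1 hx]
  have hi2 : Integrable (fun x => 2 * f x * inner ℝ (gradient f x) x / (‖x‖ ^ 2 + ε)) := by
    refine (Continuous.div ?_ hqc fun x => (hq x).ne').integrable_of_hasCompactSupport ?_
    · exact (continuous_const.mul hf.continuous).mul (hf.continuous_gradient.inner continuous_id)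
    · refine hf.2.mono fun x hx => ?_
      contrapose! hx
      simp [Function.notMem_support.1 hx]
  -- the square `‖∇f + (N - 2) / 2 · f x / (|x|² + ε)‖²` is nonnegative
  have hpt : ∀ x, (0 : ℝ) ≤ ‖gradient f x‖ ^ 2
      + ((N : ℝ) - 2) / 2 * (2 * f x * inner ℝ (gradient f x) x / (‖x‖ ^ 2 + ε))
      + (((N : ℝ) - 2) / 2) ^ 2 * (f x ^ 2 / (‖x‖ ^ 2 + ε)) := fun x => by
    have h0 := sq_nonneg ‖gradient f x + (((N : ℝ) - 2) / 2 * f x / (‖x‖ ^ 2 + ε)) • x‖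
    rw [norm_add_sq_real, inner_smul_right, norm_smul, mul_pow, Real.norm_eq_abs, sq_abs] at h0
    have h1 : (((N : ℝ) - 2) / 2 * f x / (‖x‖ ^ 2 + ε)) ^ 2 * ‖x‖ ^ 2
        ≤ (((N : ℝ) - 2) / 2) ^ 2 * (f x ^ 2 / (‖x‖ ^ 2 + ε)) := by
      have : (((N : ℝ) - 2) / 2 * f x / (‖x‖ ^ 2 + ε)) ^ 2 * ‖x‖ ^ 2
          = (((N : ℝ) - 2) / 2) ^ 2 * f x ^ 2 * (‖x‖ ^ 2 / (‖x‖ ^ 2 + ε) ^ 2) := by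
        rw [div_pow]
        ring
      have hk : ‖x‖ ^ 2 / (‖x‖ ^ 2 + ε) ^ 2 ≤ 1 / (‖x‖ ^ 2 + ε) := by
        rw [div_le_div_iff₀ (pow_pos (hq x) 2) (hq x)]
        nlinarith [hq x]
      calc _ ≤ (((N : ℝ) - 2) / 2) ^ 2 * f x ^ 2 * (1 / (‖x‖ ^ 2 + ε)) :=
            this.le.trans (mul_le_mul_of_nonneg_left hk (by positivity))
        _ = _ := by ring
    have h2 : 2 * (((N : ℝ) - 2) / 2 * f x / (‖x‖ ^ 2 + ε) * inner ℝ (gradient f x) x)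
      = ((N : ℝ) - 2) / 2 * (2 * f x * inner ℝ (gradient f x) x / (‖x‖ ^ 2 + ε)) := by ring
    linarith
  have h0 : 0 ≤ ∫ x, (‖gradient f x‖ ^ 2
      + ((N : ℝ) - 2) / 2 * (2 * f x * inner ℝ (gradient f x) x / (‖x‖ ^ 2 + ε))
      + (((N : ℝ) - 2) / 2) ^ 2 * (f x ^ 2 / (‖x‖ ^ 2 + ε))) := integral_nonneg hpt
  have hi3 := hf.integrable_norm_gradient_sq
  rw [integral_add_const_mul_add_const_mul hi3 hi2 hi1] at h0
  unfold hardyConst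
  nlinarith [mul_le_mul_of_nonneg_left hdiv hc]

theorem hardyConst_pos {N : ℕ} (hN : 3 ≤ N) : 0 < hardyConst N := by
  have : (3 : ℝ) ≤ N := by exact_mod_cast hN
  unfold hardyConst
  have : 0 < ((N : ℝ) - 2) / 2 := by linarith
  positivity

/-- The Hardy inequality for test functions, including the integrability of `f² / |x|²`. -/
theorem hardy_inequality {N : ℕ} (hN : 3 ≤ N) {f : EuclideanSpace ℝ (Fin N) → ℝ}
    (hf : IsTestFunction f) :
    Integrable (fun x => f x ^ 2 / ‖x‖ ^ 2) ∧
      hardyConst N * ∫ x, f x ^ 2 / ‖x‖ ^ 2 ≤ ∫ x, ‖gradient f x‖ ^ 2 := by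
  have hpos := hardyConst_pos hN
  set A := ∫ x, ‖gradient f x‖ ^ 2 with hA
  have hA0 : 0 ≤ A := integral_nonneg fun x => by positivity
  set ε : ℕ → ℝ := fun n => 1 / ((n : ℝ) + 1) with hε
  have hεp : ∀ n, 0 < ε n := fun n => by simp only [hε]; positivity
  have hint : ∀ n, Integrable (fun x => f x ^ 2 / (‖x‖ ^ 2 + ε n)) := fun n => by
    refine Continuous.integrable_of_hasCompactSupport
      (Continuous.div (hf.continuous.pow 2) (by fun_prop) fun x => ?_) ?_
    · have := hεp n
      positivity
    · refine hf.2.mono fun x hx => ?_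
      contrapose! hx
      simp [Function.notMem_support.1 hx]
  have hlim : ∀ᵐ x, Tendsto (fun n => f x ^ 2 / (‖x‖ ^ 2 + ε n)) atTop
      (𝓝 (f x ^ 2 / ‖x‖ ^ 2)) := by
    filter_upwards [ae_ne_zero_of_pos (N := N) (by omega)] with x hx
    refine tendsto_const_nhds.div ?_ (pow_ne_zero 2 (norm_ne_zero_iff.2 hx))
    simpa [hε] using (tendsto_const_nhds (x := ‖x‖ ^ 2)).add (tendsto_one_div_add_atTop_nhds_zero_nat (𝕜 := ℝ))
  obtain ⟨h1, h2⟩ := integrable_and_integral_le_of_tendsto_ae (c := fun _ => A / hardyConst N) hint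
    (fun n x => div_nonneg (sq_nonneg _) (add_nonneg (sq_nonneg _) (hεp n).le))
    (fun n => (le_div_iff₀' hpos).2 (hardy_regularized (by omega) hf (hεp n))) tendsto_const_nhds hlim
  exact ⟨h1, (le_div_iff₀' hpos).1 h2⟩

/-! ### Test functions inside `D^{1,2}` -/

namespace IsTestFunction

variable {N : ℕ} {f g : EuclideanSpace ℝ (Fin N) → ℝ}

theorem const_mul (hf : IsTestFunction f) (c : ℝ) : IsTestFunction (fun x => c * f x) :=
  ⟨contDiff_const.mul hf.1, hf.2.mul_left⟩

theorem gradient_const_mul (hf : IsTestFunction f) (c : ℝ) (x : EuclideanSpace ℝ (Fin N)) :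
    gradient (fun y => c * f y) x = c • gradient f x := by
  simpa using ((hasGradientAt_const x c).fun_mul (hf.hasGradientAt x)).gradient

theorem gradient_sub (hf : IsTestFunction f) (hg : IsTestFunction g)
    (x : EuclideanSpace ℝ (Fin N)) :
    gradient (fun y => f y - g y) x = gradient f x - gradient g x := by
  simpa [sub_eq_add_neg] using hf.gradient_add_const_mul hg (-1) x

theorem sub (hf : IsTestFunction f) (hg : IsTestFunction g) :
    IsTestFunction (fun x => f x - g x) := by
  simpa [sub_eq_add_neg] using hf.add_const_mul hg (-1)

theorem hasD12Gradient (hf : IsTestFunction f) : HasD12Gradient f (gradient f) where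
  memLp := hf.memLp _
  memLp_grad := hf.memLp_gradient _
  exists_approx := ⟨fun _ => f, fun _ => hf, by simp, by simp⟩

end IsTestFunction

theorem principalEigenvalue_nonneg {N : ℕ} (m : EuclideanSpace ℝ (Fin N) → ℝ) :
    0 ≤ principalEigenvalue m := by
  refine Real.sInf_nonneg ?_
  rintro t ⟨u, G, -, -, rfl⟩
  exact integral_nonneg fun x => by positivity

theorem principalEigenvalue_mul_hardyTerm_le {N : ℕ} {m f : EuclideanSpace ℝ (Fin N) → ℝ}
    (hf : IsTestFunction f) :
    principalEigenvalue m * hardyTerm m f ≤ ∫ x, ‖gradient f x‖ ^ 2 := by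
  have hnn : 0 ≤ ∫ x, ‖gradient f x‖ ^ 2 := integral_nonneg fun x => by positivity
  rcases le_or_gt (hardyTerm m f) 0 with h | h
  · exact (mul_nonpos_of_nonneg_of_nonpos (principalEigenvalue_nonneg m) h).trans hnn
  · set c : ℝ := (√(hardyTerm m f))⁻¹ with hc
    have hc2 : c ^ 2 = (hardyTerm m f)⁻¹ := by rw [hc, inv_pow, Real.sq_sqrt h.le]
    rw [← le_div_iff₀ h]
    refine csInf_le ⟨0, ?_⟩ ⟨fun x => c * f x, _, (hf.const_mul c).hasD12Gradient, ?_, ?_⟩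
    · rintro t ⟨u, G, -, -, rfl⟩
      exact integral_nonneg fun x => by positivity
    · have : ∀ x, m x / ‖x‖ ^ 2 * (c * f x) ^ 2 = c ^ 2 * (m x / ‖x‖ ^ 2 * f x ^ 2) :=
        fun x => by ring
      simp only [hardyTerm, this]
      rw [integral_const_mul, hc2]
      exact inv_mul_cancel₀ h.ne'
    · have : ∀ x, ‖gradient (fun y => c * f y) x‖ ^ 2 = c ^ 2 * ‖gradient f x‖ ^ 2 := fun x => by
        rw [hf.gradient_const_mul, norm_smul, mul_pow, Real.norm_eq_abs, sq_abs]
      simp only [this]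
      rw [integral_const_mul, hc2, div_eq_inv_mul]

/-! ### The energy form of `-Δ - Λ m / |x|²` -/

/-- The symmetric bilinear form `∫ ∇f · ∇g dx - Λ ∫ (m(x) / |x|²) f g dx`. -/
noncomputable def energyForm {N : ℕ} (Λ : ℝ) (m f g : EuclideanSpace ℝ (Fin N) → ℝ) : ℝ :=
  (∫ x, inner ℝ (gradient f x) (gradient g x)) - Λ * ∫ x, m x / ‖x‖ ^ 2 * (f x * g x)

section EnergyForm

variable {N : ℕ} {Λ B : ℝ} {m f g : EuclideanSpace ℝ (Fin N) → ℝ}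

theorem integrable_hardyWeight_mul (hN : 3 ≤ N) (hm : Continuous m) (hB : ∀ x, |m x| ≤ B)
    (hf : IsTestFunction f) (hg : IsTestFunction g) :
    Integrable (fun x => m x / ‖x‖ ^ 2 * (f x * g x)) := by
  have hi := ((hardy_inequality hN hf).1.add (hardy_inequality hN hg).1).const_mul B
  refine hi.mono' ?_ (ae_of_all _ fun x => ?_)
  · have h1 := hf.continuous.measurable
    have h2 := hg.continuous.measurable
    have h3 := hm.measurable
    exact ((h3.div (measurable_norm.pow_const 2)).mul (h1.mul h2)).aestronglyMeasurable
  · have h1 : |f x * g x| ≤ f x ^ 2 + g x ^ 2 := by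
      rw [abs_le]
      constructor <;> nlinarith [sq_nonneg (f x + g x), sq_nonneg (f x - g x)]
    have h2 : (0 : ℝ) ≤ 1 / ‖x‖ ^ 2 := by positivity
    calc ‖m x / ‖x‖ ^ 2 * (f x * g x)‖ = |m x| * |f x * g x| * (1 / ‖x‖ ^ 2) := by
          rw [Real.norm_eq_abs, abs_mul, abs_div, abs_of_nonneg (sq_nonneg ‖x‖)]
          ring
      _ ≤ B * (f x ^ 2 + g x ^ 2) * (1 / ‖x‖ ^ 2) :=
          mul_le_mul_of_nonneg_right (mul_le_mul (hB x) h1 (abs_nonneg _)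
            ((abs_nonneg _).trans (hB x))) h2
      _ = B * (f x ^ 2 / ‖x‖ ^ 2 + g x ^ 2 / ‖x‖ ^ 2) := by ring

theorem energyForm_self :
    energyForm Λ m f f = (∫ x, ‖gradient f x‖ ^ 2) - Λ * hardyTerm m f := by
  simp only [energyForm, hardyTerm, real_inner_self_eq_norm_sq, sq (f _)]

theorem energyForm_add_const_mul (hN : 3 ≤ N) (hm : Continuous m) (hB : ∀ x, |m x| ≤ B)
    (hf : IsTestFunction f) (hg : IsTestFunction g) (t : ℝ) :
    energyForm Λ m (fun x => f x + t * g x) (fun x => f x + t * g x)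
      = energyForm Λ m g g * (t * t) + 2 * energyForm Λ m f g * t + energyForm Λ m f f := by
  have h1 : ∀ x, inner ℝ (gradient (fun x => f x + t * g x) x)
      (gradient (fun x => f x + t * g x) x) = inner ℝ (gradient f x) (gradient f x)
        + (2 * t) * inner ℝ (gradient f x) (gradient g x)
        + t ^ 2 * inner ℝ (gradient g x) (gradient g x) := fun x => by
    rw [hf.gradient_add_const_mul hg]
    simp only [inner_add_left, inner_add_right, inner_smul_left, inner_smul_right, conj_trivial,
      real_inner_comm (gradient f x) (gradient g x)]
    ring
  have h2 : ∀ x, m x / ‖x‖ ^ 2 * ((f x + t * g x) * (f x + t * g x))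
      = m x / ‖x‖ ^ 2 * (f x * f x) + (2 * t) * (m x / ‖x‖ ^ 2 * (f x * g x))
        + t ^ 2 * (m x / ‖x‖ ^ 2 * (g x * g x)) := fun x => by ring
  have hw : ∀ {f g : EuclideanSpace ℝ (Fin N) → ℝ}, IsTestFunction f → IsTestFunction g →
      Integrable (fun x => m x / ‖x‖ ^ 2 * (f x * g x)) :=
    fun hf hg => integrable_hardyWeight_mul hN hm hB hf hg
  simp only [energyForm, h1, h2]
  rw [integral_add_const_mul_add_const_mul (hf.integrable_inner_gradient hf)
      (hf.integrable_inner_gradient hg) (hg.integrable_inner_gradient hg),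
    integral_add_const_mul_add_const_mul (hw hf hf) (hw hf hg) (hw hg hg)]
  ring

/-- The Cauchy–Schwarz inequality for the energy form at the principal eigenvalue, where the form
is positive semidefinite. -/
theorem energyForm_sq_le (hN : 3 ≤ N) (hm : Continuous m) (hB : ∀ x, |m x| ≤ B)
    (hf : IsTestFunction f) (hg : IsTestFunction g) :
    energyForm (principalEigenvalue m) m f g ^ 2 ≤
      energyForm (principalEigenvalue m) m f f * energyForm (principalEigenvalue m) m g g := by
  have h := discrim_le_zero (a := energyForm (principalEigenvalue m) m g g)
    (b := 2 * energyForm (principalEigenvalue m) m f g)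
    (c := energyForm (principalEigenvalue m) m f f) fun t => by
      rw [← energyForm_add_const_mul hN hm hB hf hg, energyForm_self, sub_nonneg]
      exact principalEigenvalue_mul_hardyTerm_le (hf.add_const_mul hg t)
  unfold discrim at h
  linarith

/-- By the Hardy inequality the energy form is bounded on `D^{1,2}`. -/
theorem energyForm_self_le (hN : 3 ≤ N) (hΛ : 0 ≤ Λ) (hm : Continuous m) (hB : ∀ x, |m x| ≤ B)
    (hf : IsTestFunction f) :
    energyForm Λ m f f ≤ (1 + Λ * B / hardyConst N) * ∫ x, ‖gradient f x‖ ^ 2 := by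
  obtain ⟨h1, h2⟩ := hardy_inequality hN hf
  have hpos := hardyConst_pos hN
  have hB0 : 0 ≤ B := (abs_nonneg _).trans (hB 0)
  have h3 : -hardyTerm m f ≤ B * ∫ x, f x ^ 2 / ‖x‖ ^ 2 := by
    rw [hardyTerm, ← integral_neg, ← integral_const_mul]
    have hi := (integrable_hardyWeight_mul hN hm hB hf hf).neg
    simp only [← sq] at hi
    refine integral_mono hi (h1.const_mul B) fun x => ?_
    calc -(m x / ‖x‖ ^ 2 * f x ^ 2) = -m x * (f x ^ 2 / ‖x‖ ^ 2) := by ring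
      _ ≤ B * (f x ^ 2 / ‖x‖ ^ 2) :=
        mul_le_mul_of_nonneg_right ((neg_le_abs _).trans (hB x)) (by positivity)
  have h4 : ∫ x, f x ^ 2 / ‖x‖ ^ 2 ≤ (∫ x, ‖gradient f x‖ ^ 2) / hardyConst N :=
    (le_div_iff₀' hpos).2 h2
  rw [energyForm_self]
  calc _ = (∫ x, ‖gradient f x‖ ^ 2) + Λ * -hardyTerm m f := by ring
    _ ≤ (∫ x, ‖gradient f x‖ ^ 2) + Λ * (B * ((∫ x, ‖gradient f x‖ ^ 2) / hardyConst N)) := by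
        gcongr
        exact h3.trans (mul_le_mul_of_nonneg_left h4 hB0)
    _ = _ := by ring

end EnergyForm

/-! ### Approximation of `D^{1,2}` functions -/

theorem integral_norm_sq_eq_toReal_eLpNorm_sq {α V : Type*} [MeasurableSpace α] {μ : Measure α}
    [NormedAddCommGroup V] {v : α → V} (hv : MemLp v 2 μ) :
    ∫ x, ‖v x‖ ^ 2 ∂μ = (eLpNorm v 2 μ).toReal ^ 2 := by
  have h := hv.eLpNorm_eq_integral_rpow_norm two_ne_zero ENNReal.ofNat_ne_top
  have h0 : 0 ≤ ∫ x, ‖v x‖ ^ 2 ∂μ := integral_nonneg fun x => by positivity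
  simp only [ENNReal.toReal_ofNat, Real.rpow_two] at h
  rw [h, ENNReal.toReal_ofReal (by positivity), ← Real.rpow_natCast, ← Real.rpow_mul h0]
  norm_num

/-- Test functions approximating `u` in `D^{1,2}`. The approximation also holds almost everywhere
and, by the Hardy inequality, in `L²(|x|⁻² dx)`. -/
theorem HasD12Gradient.exists_seq {N : ℕ} (hN : 3 ≤ N) {u : EuclideanSpace ℝ (Fin N) → ℝ}
    {G : EuclideanSpace ℝ (Fin N) → EuclideanSpace ℝ (Fin N)} (h : HasD12Gradient u G) :
    ∃ f : ℕ → EuclideanSpace ℝ (Fin N) → ℝ, (∀ k, IsTestFunction (f k)) ∧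
      (∀ᵐ x, Tendsto (fun k => f k x) atTop (𝓝 (u x))) ∧
      Tendsto (fun k => ∫ x, ‖gradient (f k) x - G x‖ ^ 2) atTop (𝓝 0) ∧
      (∀ k, Integrable (fun x => (f k x - u x) ^ 2 / ‖x‖ ^ 2)) ∧
      Tendsto (fun k => ∫ x, (f k x - u x) ^ 2 / ‖x‖ ^ 2) atTop (𝓝 0) := by
  obtain ⟨f, hf, hfu, hfG⟩ := h.exists_approx
  have hf' : ∀ k, IsTestFunction (f k) := hf
  have hpos := hardyConst_pos hN
  have hs0 : 0 < sobolevExp N := by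
    have : (3 : ℝ) ≤ N := by exact_mod_cast hN
    unfold sobolevExp
    exact div_pos (by linarith) (by linarith)
  obtain ⟨ns, hns, hae⟩ := (tendstoInMeasure_of_tendsto_eLpNorm
    (ENNReal.ofReal_pos.2 hs0).ne' (fun k => (hf' k).continuous.aestronglyMeasurable)
    h.memLp.1 hfu).exists_seq_tendsto_ae
  set d : ℕ → ℝ := fun k => ∫ x, ‖gradient (f (ns k)) x - G x‖ ^ 2 with hd
  have hdG : ∀ k, MemLp (fun x => gradient (f k) x - G x) 2 volume := fun k =>
    ((hf' k).memLp_gradient 2).sub h.memLp_grad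
  have hd0 : Tendsto d atTop (𝓝 0) := by
    have h1 : Tendsto (fun k => (eLpNorm (fun x => gradient (f (ns k)) x - G x) 2 volume).toReal ^ 2)
        atTop (𝓝 0) := by
      simpa [Function.comp_def] using
        (((ENNReal.tendsto_toReal ENNReal.zero_ne_top).comp hfG).comp hns.tendsto_atTop).pow 2
    refine h1.congr fun k => ?_
    exact (integral_norm_sq_eq_toReal_eLpNorm_sq (hdG _)).symm
  have hi : ∀ k, Integrable (fun x => ‖gradient (f k) x - G x‖ ^ 2) := fun k => by
    simpa using (hdG k).integrable_norm_pow (p := 2) two_ne_zero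
  have hdiff : ∀ k j, ∫ x, (f (ns k) x - f (ns j) x) ^ 2 / ‖x‖ ^ 2
      ≤ 2 / hardyConst N * (d k + d j) := fun k j => by
    have hkj := (hf' (ns k)).sub (hf' (ns j))
    have h1 : ∫ x, ‖gradient (fun y => f (ns k) y - f (ns j) y) x‖ ^ 2 ≤ 2 * (d k + d j) := by
      rw [hd, ← integral_add (hi _) (hi _), ← integral_const_mul]
      refine integral_mono hkj.integrable_norm_gradient_sq (((hi _).add (hi _)).const_mul 2)
        fun x => ?_
      simp only [(hf' (ns k)).gradient_sub (hf' (ns j))]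
      rw [← sub_sub_sub_cancel_right _ _ (G x)]
      have := norm_sub_le (gradient (f (ns k)) x - G x) (gradient (f (ns j)) x - G x)
      calc _ ≤ (‖gradient (f (ns k)) x - G x‖ + ‖gradient (f (ns j)) x - G x‖) ^ 2 := by gcongr
        _ ≤ _ := add_sq_le
    have h2 := (hardy_inequality hN hkj).2.trans h1
    rw [← le_div_iff₀' hpos] at h2
    exact h2.trans_eq (by ring)
  have hlimit : ∀ k, Integrable (fun x => (f (ns k) x - u x) ^ 2 / ‖x‖ ^ 2) ∧
      ∫ x, (f (ns k) x - u x) ^ 2 / ‖x‖ ^ 2 ≤ 2 / hardyConst N * d k := fun k => by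
    refine integrable_and_integral_le_of_tendsto_ae
      (fun j => (hardy_inequality hN ((hf' (ns k)).sub (hf' (ns j)))).1)
      (fun j x => by positivity) (hdiff k) ?_ ?_
    · simpa using ((tendsto_const_nhds (x := d k)).add hd0).const_mul (2 / hardyConst N)
    · filter_upwards [hae] with x hx
      exact ((tendsto_const_nhds.sub hx).pow 2).div_const _
  refine ⟨fun k => f (ns k), fun k => hf' _, hae, hd0, fun k => (hlimit k).1, ?_⟩
  refine squeeze_zero (fun k => integral_nonneg fun x => by positivity) (fun k => (hlimit k).2) ?_
  simpa using hd0.const_mul (2 / hardyConst N)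

/-- Along a sequence of test functions approximating a ground state, the energy form at the
principal eigenvalue tends to `0`. -/
theorem tendsto_energyForm_self {N : ℕ} (hN : 3 ≤ N) {m u : EuclideanSpace ℝ (Fin N) → ℝ}
    {G : EuclideanSpace ℝ (Fin N) → EuclideanSpace ℝ (Fin N)} {B Λ : ℝ} (hm : Continuous m)
    (hB : ∀ x, |m x| ≤ B) (h : HasD12Gradient u G)
    (hΛ : ∫ x, ‖G x‖ ^ 2 = Λ * hardyTerm m u)
    {f : ℕ → EuclideanSpace ℝ (Fin N) → ℝ} (hf : ∀ k, IsTestFunction (f k))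
    (hG : Tendsto (fun k => ∫ x, ‖gradient (f k) x - G x‖ ^ 2) atTop (𝓝 0))
    (hi : ∀ k, Integrable (fun x => (f k x - u x) ^ 2 / ‖x‖ ^ 2))
    (hu : Tendsto (fun k => ∫ x, (f k x - u x) ^ 2 / ‖x‖ ^ 2) atTop (𝓝 0)) :
    Tendsto (fun k => energyForm Λ m (f k) (f k)) atTop (𝓝 0) := by
  have hB0 : 0 ≤ B := (abs_nonneg _).trans (hB 0)
  have h1 : Tendsto (fun k => ∫ x, ‖gradient (f k) x‖ ^ 2) atTop (𝓝 (∫ x, ‖G x‖ ^ 2)) := by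
    simpa using tendsto_integral_mul_norm_sq (w := fun _ => 1) (B := 1)
      aestronglyMeasurable_const zero_le_one (by simp) (fun k => (hf k).memLp_gradient 2)
      h.memLp_grad hG
  have hum : AEStronglyMeasurable u volume := h.memLp.1
  have hnm : AEStronglyMeasurable (fun x : EuclideanSpace ℝ (Fin N) => ‖x‖) volume :=
    continuous_norm.aestronglyMeasurable
  have hdm : ∀ k, MemLp (fun x => (f k x - u x) / ‖x‖) 2 volume := fun k => by
    refine (memLp_two_iff_integrable_sq ?_).2 (by simpa only [div_pow] using hi k)
    exact (((hf k).continuous.aestronglyMeasurable.sub hum).aemeasurable.div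
      hnm.aemeasurable).aestronglyMeasurable
  have hfm : ∀ k, MemLp (fun x => f k x / ‖x‖) 2 volume := fun k => by
    refine (memLp_two_iff_integrable_sq ?_).2
      (by simpa only [div_pow] using (hardy_inequality hN (hf k)).1)
    exact ((hf k).continuous.aestronglyMeasurable.aemeasurable.div
      hnm.aemeasurable).aestronglyMeasurable
  have hm2 : MemLp (fun x => u x / ‖x‖) 2 volume := by
    refine ((hfm 0).sub (hdm 0)).ae_eq (ae_of_all _ fun x => ?_)
    simp only [Pi.sub_apply]
    ring
  have h2 : Tendsto (fun k => hardyTerm m (f k)) atTop (𝓝 (hardyTerm m u)) := by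
    have h3 : ∀ v : EuclideanSpace ℝ (Fin N) → ℝ,
        hardyTerm m v = ∫ x, m x * ‖v x / ‖x‖‖ ^ 2 := fun v => by
      unfold hardyTerm
      refine integral_congr_ae (ae_of_all _ fun x => ?_)
      simp only [Real.norm_eq_abs, sq_abs]
      ring
    simp only [h3]
    refine tendsto_integral_mul_norm_sq hm.aestronglyMeasurable hB0 hB hfm hm2 (hu.congr fun k => ?_)
    refine integral_congr_ae (ae_of_all _ fun x => ?_)
    simp only [Real.norm_eq_abs, sq_abs]
    ring
  simp only [energyForm_self]
  simpa [hΛ] using h1.sub (h2.const_mul Λ)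

/-! ### The Sobolev inequality -/

theorem exists_sobolev_const {N : ℕ} (hN : 3 ≤ N) :
    ∃ C : NNReal, ∀ f : EuclideanSpace ℝ (Fin N) → ℝ, IsTestFunction f →
      eLpNorm f (ENNReal.ofReal (sobolevExp N)) volume
        ≤ C * ENNReal.ofReal √(∫ x, ‖gradient f x‖ ^ 2) := by
  have hN' : (3 : ℝ) ≤ N := by exact_mod_cast hN
  refine ⟨eLpNormLESNormFDerivOfEqInnerConst
    (volume : Measure (EuclideanSpace ℝ (Fin N))) (2 : NNReal), fun f hf => ?_⟩
  have h := eLpNorm_le_eLpNorm_fderiv_of_eq_inner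
    (volume : Measure (EuclideanSpace ℝ (Fin N))) hf.contDiff_one hf.2 (p := 2)
    (p' := (sobolevExp N).toNNReal) one_le_two (by simpa using by omega) (by
      have : 0 ≤ sobolevExp N := div_nonneg (by linarith) (by linarith)
      rw [Real.coe_toNNReal _ this, finrank_euclideanSpace_fin, sobolevExp]
      have h2 : (N : ℝ) - 2 ≠ 0 := by linarith
      have h3 : (N : ℝ) ≠ 0 := by linarith
      push_cast
      field_simp)
  refine h.trans (mul_le_mul_right ?_ _)
  have h2 : eLpNorm (fderiv ℝ f) 2 volume = eLpNorm (gradient f) 2 volume := by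
    refine eLpNorm_congr_norm_ae (ae_of_all _ fun x => ?_)
    rw [← toDual_gradient, LinearIsometryEquiv.norm_map]
  rw [integral_norm_sq_eq_toReal_eLpNorm_sq (hf.memLp_gradient 2),
    Real.sqrt_sq ENNReal.toReal_nonneg, ENNReal.ofReal_toReal (hf.memLp_gradient 2).2.ne]
  exact h2.le

/-! ### A Caccioppoli inequality for powers -/

/-- Growth conditions on a weight `g` that models a truncated power `|t| ^ s`: it is smooth, bounded
by `K`, and its logarithmic derivative `t g'(t) / g(t)` lies in `[0, s]`. -/
structure IsPowerWeight (s K : ℝ) (g : ℝ → ℝ) : Prop where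
  contDiff : ContDiff ℝ ∞ g
  nonneg : ∀ t, 0 ≤ g t
  le_bound : ∀ t, g t ≤ K
  mul_deriv_nonneg : ∀ t, 0 ≤ t * deriv g t
  mul_deriv_le : ∀ t, t * deriv g t ≤ s * g t

namespace IsPowerWeight

variable {s K : ℝ} {g : ℝ → ℝ}

theorem hasDerivAt (hg : IsPowerWeight s K g) (t : ℝ) : HasDerivAt g (deriv g t) t :=
  ((hg.contDiff.differentiable (by simp)) t).hasDerivAt

theorem bound_nonneg (hg : IsPowerWeight s K g) : 0 ≤ K := (hg.nonneg 0).trans (hg.le_bound 0)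

theorem abs_mul_sub_mul_le (hg : IsPowerWeight s K g) (hs : 0 ≤ s) (a b : ℝ) :
    |a * g a - b * g b| ≤ (1 + s) * K * |a - b| := by
  have hd : ∀ t, HasDerivAt (fun t => t * g t) (1 * g t + t * deriv g t) t := fun t =>
    (hasDerivAt_id t).mul (hg.hasDerivAt t)
  refine Convex.norm_image_sub_le_of_norm_hasDerivWithin_le (s := Set.univ)
    (fun t _ => (hd t).hasDerivWithinAt) (fun t _ => ?_) convex_univ (Set.mem_univ b)
    (Set.mem_univ a)
  have h1 := hg.nonneg t
  have h2 := hg.mul_deriv_nonneg t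
  rw [Real.norm_eq_abs, abs_of_nonneg (by linarith)]
  nlinarith [hg.mul_deriv_le t, hg.le_bound t]

end IsPowerWeight

section Caccioppoli

variable {N : ℕ} {s K M : ℝ} {g : ℝ → ℝ} {f η : EuclideanSpace ℝ (Fin N) → ℝ}

/-- The localized power `η f g(f)`, a test function if `f` is one. -/
theorem isTestFunction_powerCutoff (hg : IsPowerWeight s K g) (hf : IsTestFunction f)
    (hη : IsTestFunction η) : IsTestFunction (fun x => f x * (g (f x) * η x)) :=
  hf.mul_left ((hg.contDiff.comp hf.1).mul hη.1)

theorem isTestFunction_powerTest (hg : IsPowerWeight s K g) (hf : IsTestFunction f)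
    (hη : IsTestFunction η) : IsTestFunction (fun x => f x * (g (f x) * η x) ^ 2) :=
  hf.mul_left (((hg.contDiff.comp hf.1).mul hη.1).pow 2)

theorem gradient_powerCutoff (hg : IsPowerWeight s K g) (hf : IsTestFunction f)
    (hη : IsTestFunction η) (x : EuclideanSpace ℝ (Fin N)) :
    gradient (fun x => f x * (g (f x) * η x)) x
      = ((g (f x) + f x * deriv g (f x)) * η x) • gradient f x
        + (f x * g (f x)) • gradient η x := by
  have h := (hf.hasGradientAt x).fun_mul
    (((hg.hasDerivAt (f x)).comp_hasGradientAt (hf.hasGradientAt x)).fun_mul (hη.hasGradientAt x))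
  rw [h.gradient]
  module

theorem gradient_powerTest (hg : IsPowerWeight s K g) (hf : IsTestFunction f)
    (hη : IsTestFunction η) (x : EuclideanSpace ℝ (Fin N)) :
    gradient (fun x => f x * (g (f x) * η x) ^ 2) x
      = ((g (f x) + 2 * (f x * deriv g (f x))) * g (f x) * η x ^ 2) • gradient f x
        + (2 * η x * f x * g (f x) ^ 2) • gradient η x := by
  have hW := ((hg.hasDerivAt (f x)).comp_hasGradientAt (hf.hasGradientAt x)).fun_mul
    (hη.hasGradientAt x)
  have h := (hf.hasGradientAt x).fun_mul (hW.fun_mul hW)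
  simp only [← sq] at h
  rw [h.gradient]
  module

/-- Writing `w = η f g(f)` and `ψ = η² f g(f)²`, the difference `|∇w|² - ∇f · ∇ψ` is the square
of `η f g'(f) ∇f + f g(f) ∇η`, which is small relative to `|∇w|²` up to a term without `∇f`. -/
theorem norm_gradient_powerCutoff_sq_le (hg : IsPowerWeight s K g) (hs0 : 0 ≤ s) (hs1 : s ≤ 1)
    (hf : IsTestFunction f) (hη : IsTestFunction η) (x : EuclideanSpace ℝ (Fin N)) :
    (1 - 4 * s ^ 2) * ‖gradient (fun x => f x * (g (f x) * η x)) x‖ ^ 2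
      ≤ inner ℝ (gradient f x) (gradient (fun x => f x * (g (f x) * η x) ^ 2) x)
        + 6 * ((f x * g (f x)) ^ 2 * ‖gradient η x‖ ^ 2) := by
  rw [gradient_powerTest hg hf hη]
  have hw := gradient_powerCutoff hg hf hη x
  set V := gradient (fun x => f x * (g (f x) * η x)) x
  set a := gradient f x
  set b := gradient η x
  set p := f x * deriv g (f x) with hp
  have hp0 : 0 ≤ p := hg.mul_deriv_nonneg _
  have hps : p ≤ s * g (f x) := hg.mul_deriv_le _
  have hg0 := hg.nonneg (f x)
  set γ := g (f x)
  have hid : ‖V‖ ^ 2 - inner ℝ a (((γ + 2 * p) * γ * η x ^ 2) • a + (2 * η x * f x * γ ^ 2) • b)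
      = ‖(p * η x) • a + (f x * γ) • b‖ ^ 2 := by
    rw [hw]
    simp only [← real_inner_self_eq_norm_sq, inner_add_left, inner_add_right, inner_smul_left,
      inner_smul_right, conj_trivial, real_inner_comm a b]
    ring
  have h1 : ‖(p * η x) • a + (f x * γ) • b‖ ^ 2
      ≤ 2 * ((p * η x) ^ 2 * ‖a‖ ^ 2 + (f x * γ) ^ 2 * ‖b‖ ^ 2) := by
    calc _ ≤ (‖(p * η x) • a‖ + ‖(f x * γ) • b‖) ^ 2 := by
          gcongr
          exact norm_add_le _ _
      _ ≤ 2 * (‖(p * η x) • a‖ ^ 2 + ‖(f x * γ) • b‖ ^ 2) := add_sq_le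
      _ = _ := by simp only [norm_smul, mul_pow, Real.norm_eq_abs, sq_abs]
  have h2 : ((γ + p) * η x) ^ 2 * ‖a‖ ^ 2 ≤ 2 * (‖V‖ ^ 2 + (f x * γ) ^ 2 * ‖b‖ ^ 2) := by
    have : ((γ + p) * η x) • a = V - (f x * γ) • b := by rw [hw]; abel
    calc ((γ + p) * η x) ^ 2 * ‖a‖ ^ 2 = ‖((γ + p) * η x) • a‖ ^ 2 := by
          simp only [norm_smul, mul_pow, Real.norm_eq_abs, sq_abs]
      _ ≤ (‖V‖ + ‖(f x * γ) • b‖) ^ 2 := by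
          rw [this]
          gcongr
          exact norm_sub_le _ _
      _ ≤ 2 * (‖V‖ ^ 2 + ‖(f x * γ) • b‖ ^ 2) := add_sq_le
      _ = _ := by simp only [norm_smul, mul_pow, Real.norm_eq_abs, sq_abs]
  have h3 : (p * η x) ^ 2 * ‖a‖ ^ 2 ≤ s ^ 2 * (((γ + p) * η x) ^ 2 * ‖a‖ ^ 2) := by
    have : p ^ 2 ≤ s ^ 2 * (γ + p) ^ 2 := by
      rw [← mul_pow]
      gcongr
      nlinarith
    calc (p * η x) ^ 2 * ‖a‖ ^ 2 = p ^ 2 * (η x ^ 2 * ‖a‖ ^ 2) := by ring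
      _ ≤ s ^ 2 * (γ + p) ^ 2 * (η x ^ 2 * ‖a‖ ^ 2) :=
        mul_le_mul_of_nonneg_right this (by positivity)
      _ = _ := by ring
  have h4 : s ^ 2 * (((γ + p) * η x) ^ 2 * ‖a‖ ^ 2)
      ≤ s ^ 2 * (2 * (‖V‖ ^ 2 + (f x * γ) ^ 2 * ‖b‖ ^ 2)) := by gcongr
  have h5 : s ^ 2 * ((f x * γ) ^ 2 * ‖b‖ ^ 2) ≤ 1 * ((f x * γ) ^ 2 * ‖b‖ ^ 2) := by
    gcongr
    nlinarith
  linarith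

theorem integrable_powerCutoff_error (hg : IsPowerWeight s K g) (hf : IsTestFunction f)
    (hη : IsTestFunction η) :
    Integrable (fun x => (f x * g (f x)) ^ 2 * ‖gradient η x‖ ^ 2) := by
  refine Continuous.integrable_of_hasCompactSupport ?_ ?_
  · exact ((hf.continuous.mul (hg.contDiff.continuous.comp hf.continuous)).pow 2).mul
      (hη.continuous_gradient.norm.pow 2)
  · refine hf.2.mono fun x hx => ?_
    contrapose! hx
    simp [Function.notMem_support.1 hx]

/-- The Caccioppoli inequality: on the support of `η` the potential `Λ m / |x|²` stays below `κ`
times the Hardy potential, so it is absorbed by the Hardy inequality for `η f g(f)`. -/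
theorem caccioppoli_powerCutoff (hN : 3 ≤ N) {Λ B κ : ℝ} {m : EuclideanSpace ℝ (Fin N) → ℝ}
    (hm : Continuous m) (hB : ∀ x, |m x| ≤ B) (hκ : 0 ≤ κ)
    (hκm : ∀ x, η x ≠ 0 → Λ * m x ≤ κ * hardyConst N)
    (hg : IsPowerWeight s K g) (hs0 : 0 ≤ s) (hs1 : s ≤ 1)
    (hf : IsTestFunction f) (hη : IsTestFunction η) :
    (1 - κ - 4 * s ^ 2) * ∫ x, ‖gradient (fun x => f x * (g (f x) * η x)) x‖ ^ 2
      ≤ energyForm Λ m f (fun x => f x * (g (f x) * η x) ^ 2)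
        + 6 * ∫ x, (f x * g (f x)) ^ 2 * ‖gradient η x‖ ^ 2 := by
  have hw := isTestFunction_powerCutoff hg hf hη
  have hψ := isTestFunction_powerTest hg hf hη
  have hE := integrable_powerCutoff_error hg hf hη
  set w := fun x => f x * (g (f x) * η x) with hwd
  set ψ := fun x => f x * (g (f x) * η x) ^ 2 with hψd
  have h1 : (1 - 4 * s ^ 2) * ∫ x, ‖gradient w x‖ ^ 2 ≤ (∫ x, inner ℝ (gradient f x) (gradient ψ x))
      + 6 * ∫ x, (f x * g (f x)) ^ 2 * ‖gradient η x‖ ^ 2 := by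
    rw [← integral_const_mul, ← integral_const_mul,
      ← integral_add (hf.integrable_inner_gradient hψ) (hE.const_mul 6)]
    exact integral_mono (hw.integrable_norm_gradient_sq.const_mul _)
      ((hf.integrable_inner_gradient hψ).add (hE.const_mul 6))
      (norm_gradient_powerCutoff_sq_le hg hs0 hs1 hf hη)
  obtain ⟨hi, hH⟩ := hardy_inequality hN hw
  have h2 : Λ * ∫ x, m x / ‖x‖ ^ 2 * (f x * ψ x) ≤ κ * ∫ x, ‖gradient w x‖ ^ 2 := by
    calc Λ * ∫ x, m x / ‖x‖ ^ 2 * (f x * ψ x)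
        ≤ κ * hardyConst N * ∫ x, w x ^ 2 / ‖x‖ ^ 2 := by
          rw [← integral_const_mul, ← integral_const_mul]
          refine integral_mono ((integrable_hardyWeight_mul hN hm hB hf hψ).const_mul _)
            (hi.const_mul _) fun x => ?_
          have hid : Λ * (m x / ‖x‖ ^ 2 * (f x * ψ x)) = Λ * m x * (w x ^ 2 / ‖x‖ ^ 2) := by
            simp only [hwd, hψd]
            ring
          simp only [hid]
          by_cases hx : η x = 0
          · simp [hwd, hx]
          · exact mul_le_mul_of_nonneg_right (hκm x hx) (by positivity)
      _ ≤ κ * ∫ x, ‖gradient w x‖ ^ 2 := by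
          rw [mul_assoc]
          exact mul_le_mul_of_nonneg_left hH hκ
  unfold energyForm
  linarith

/-- The gradient of a compactly supported function is at most a multiple of `1 / |x|`. -/
theorem exists_norm_mul_norm_gradient_le (hη : IsTestFunction η) :
    ∃ M, ∀ x, ‖x‖ * ‖gradient η x‖ ≤ M := by
  have hc : Continuous fun x => ‖x‖ * ‖gradient η x‖ :=
    continuous_norm.mul hη.continuous_gradient.norm
  obtain ⟨M, hM⟩ := hc.bounded_above_of_compact_support
    (hη.hasCompactSupport_gradient.norm.mul_left)
  exact ⟨M, fun x => (le_abs_self _).trans (hM x)⟩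

theorem norm_gradient_sq_le_div (hM : ∀ x, ‖x‖ * ‖gradient η x‖ ≤ M)
    {x : EuclideanSpace ℝ (Fin N)} (hx : x ≠ 0) : ‖gradient η x‖ ^ 2 ≤ M ^ 2 / ‖x‖ ^ 2 := by
  have hx' : 0 < ‖x‖ := norm_pos_iff.2 hx
  rw [le_div_iff₀ (by positivity), ← mul_pow, mul_comm]
  gcongr
  exact hM x

theorem integral_norm_gradient_powerTest_sq_le (hN : 3 ≤ N) (hg : IsPowerWeight s K g)
    (hs : s ≤ 1) (hf : IsTestFunction f) (hη : IsTestFunction η) (hη1 : ∀ x, |η x| ≤ 1)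
    (hM : ∀ x, ‖x‖ * ‖gradient η x‖ ≤ M) :
    ∫ x, ‖gradient (fun x => f x * (g (f x) * η x) ^ 2) x‖ ^ 2
      ≤ (18 * K ^ 4 + 8 * K ^ 4 * M ^ 2 / hardyConst N) * ∫ x, ‖gradient f x‖ ^ 2 := by
  obtain ⟨hi, hH⟩ := hardy_inequality hN hf
  have hpos := hardyConst_pos hN
  have hK := hg.bound_nonneg
  have hH' : ∫ x, f x ^ 2 / ‖x‖ ^ 2 ≤ (∫ x, ‖gradient f x‖ ^ 2) / hardyConst N :=
    (le_div_iff₀' hpos).2 hH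
  calc ∫ x, ‖gradient (fun x => f x * (g (f x) * η x) ^ 2) x‖ ^ 2
      ≤ ∫ x, (18 * K ^ 4 * ‖gradient f x‖ ^ 2 + 8 * K ^ 4 * M ^ 2 * (f x ^ 2 / ‖x‖ ^ 2)) := by
        refine integral_mono_ae (isTestFunction_powerTest hg hf hη).integrable_norm_gradient_sq
          ((hf.integrable_norm_gradient_sq.const_mul _).add (hi.const_mul _)) ?_
        filter_upwards [ae_ne_zero_of_pos (N := N) (by omega)] with x hx
        rw [gradient_powerTest hg hf hη]
        have hp0 : 0 ≤ f x * deriv g (f x) := hg.mul_deriv_nonneg _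
        have hps : f x * deriv g (f x) ≤ s * g (f x) := hg.mul_deriv_le _
        have hg0 := hg.nonneg (f x)
        have hgK := hg.le_bound (f x)
        have hpK : f x * deriv g (f x) ≤ K := by nlinarith
        have hη2 : η x ^ 2 ≤ 1 := by simpa using (sq_le_one_iff_abs_le_one _).2 (hη1 x)
        set p := f x * deriv g (f x)
        set γ := g (f x)
        have e1 : ((γ + 2 * p) * γ * η x ^ 2) ^ 2 ≤ 9 * K ^ 4 := by
          have : (γ + 2 * p) * γ * η x ^ 2 ≤ (K + 2 * K) * K * 1 := by gcongr
          calc _ ≤ ((K + 2 * K) * K * 1) ^ 2 := by gcongr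
            _ = _ := by ring
        have e2 : (2 * η x * f x * γ ^ 2) ^ 2 ≤ 4 * K ^ 4 * f x ^ 2 := by
          calc (2 * η x * f x * γ ^ 2) ^ 2 = 4 * γ ^ 4 * f x ^ 2 * η x ^ 2 := by ring
            _ ≤ 4 * K ^ 4 * f x ^ 2 * 1 := by gcongr
            _ = _ := by ring
        have e3 := norm_gradient_sq_le_div hM hx
        calc _ ≤ (‖((γ + 2 * p) * γ * η x ^ 2) • gradient f x‖
              + ‖(2 * η x * f x * γ ^ 2) • gradient η x‖) ^ 2 := by
              gcongr
              exact norm_add_le _ _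
          _ ≤ 2 * (‖((γ + 2 * p) * γ * η x ^ 2) • gradient f x‖ ^ 2
              + ‖(2 * η x * f x * γ ^ 2) • gradient η x‖ ^ 2) := add_sq_le
          _ = 2 * (((γ + 2 * p) * γ * η x ^ 2) ^ 2 * ‖gradient f x‖ ^ 2
              + (2 * η x * f x * γ ^ 2) ^ 2 * ‖gradient η x‖ ^ 2) := by
              simp only [norm_smul, mul_pow, Real.norm_eq_abs, sq_abs]
          _ ≤ 2 * (9 * K ^ 4 * ‖gradient f x‖ ^ 2
              + 4 * K ^ 4 * f x ^ 2 * (M ^ 2 / ‖x‖ ^ 2)) := by gcongr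
          _ = _ := by ring
    _ = 18 * K ^ 4 * (∫ x, ‖gradient f x‖ ^ 2)
        + 8 * K ^ 4 * M ^ 2 * ∫ x, f x ^ 2 / ‖x‖ ^ 2 := by
        rw [integral_add (hf.integrable_norm_gradient_sq.const_mul _) (hi.const_mul _),
          integral_const_mul, integral_const_mul]
    _ ≤ 18 * K ^ 4 * (∫ x, ‖gradient f x‖ ^ 2)
        + 8 * K ^ 4 * M ^ 2 * ((∫ x, ‖gradient f x‖ ^ 2) / hardyConst N) := by gcongr
    _ = _ := by ring

end Caccioppoli

/-! ### A priori bound for the ground state -/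

/-- The localized power `η u g(u)` of a minimizer `u` is bounded in `L^{2*}` by a constant that does
not depend on the bound `K` of the weight `g`. -/
theorem eLpNorm_powerCutoff_le {N : ℕ} (hN : 3 ≤ N) {s K B κ : ℝ} {g : ℝ → ℝ}
    {m u η : EuclideanSpace ℝ (Fin N) → ℝ}
    {G : EuclideanSpace ℝ (Fin N) → EuclideanSpace ℝ (Fin N)}
    (hm : Continuous m) (hB : ∀ x, |m x| ≤ B) (hκ : 0 ≤ κ)
    (hκm : ∀ x, η x ≠ 0 → principalEigenvalue m * m x ≤ κ * hardyConst N)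
    (hu : HasD12Gradient u G)
    (hmin : ∫ x, ‖G x‖ ^ 2 = principalEigenvalue m * hardyTerm m u)
    (hg : IsPowerWeight s K g) (hs0 : 0 ≤ s) (hs1 : s ≤ 1) (hsκ : 0 < 1 - κ - 4 * s ^ 2)
    (hη : IsTestFunction η) (hη1 : ∀ x, |η x| ≤ 1) {C : NNReal}
    (hC : ∀ f : EuclideanSpace ℝ (Fin N) → ℝ, IsTestFunction f →
      eLpNorm f (ENNReal.ofReal (sobolevExp N)) volume
        ≤ C * ENNReal.ofReal √(∫ x, ‖gradient f x‖ ^ 2))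
    {A : ℝ} (hA : ∫ x, (u x * g (u x)) ^ 2 * ‖gradient η x‖ ^ 2 ≤ A) :
    eLpNorm (fun x => u x * (g (u x) * η x)) (ENNReal.ofReal (sobolevExp N)) volume
      ≤ C * ENNReal.ofReal √(12 * A / (1 - κ - 4 * s ^ 2)) := by
  obtain ⟨f, hf, hae, hG, hi, h0⟩ := hu.exists_seq hN
  obtain ⟨M, hM⟩ := exists_norm_mul_norm_gradient_le hη
  set Λ := principalEigenvalue m with hΛ
  have hK := hg.bound_nonneg
  have hne := ae_ne_zero_of_pos (N := N) (by omega)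
  set ψ : ℕ → EuclideanSpace ℝ (Fin N) → ℝ := fun k x => f k x * (g (f k x) * η x) ^ 2 with hψd
  have hψ : ∀ k, IsTestFunction (ψ k) := fun k => isTestFunction_powerTest hg (hf k) hη
  have hD : Tendsto (fun k => ∫ x, ‖gradient (f k) x‖ ^ 2) atTop (𝓝 (∫ x, ‖G x‖ ^ 2)) := by
    simpa using tendsto_integral_mul_norm_sq (w := fun _ => 1) (B := 1)
      aestronglyMeasurable_const zero_le_one (by simp) (fun k => (hf k).memLp_gradient 2)
      hu.memLp_grad hG
  have hQ := tendsto_energyForm_self hN hm hB hu hmin hf hG hi h0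
  -- the Euler–Lagrange equation holds in the limit, because `energyForm Λ m (ψ k) (ψ k)` is bounded
  have hE : Tendsto (fun k => energyForm Λ m (f k) (ψ k)) atTop (𝓝 0) := by
    set c := (1 + Λ * B / hardyConst N) *
      (18 * K ^ 4 + 8 * K ^ 4 * M ^ 2 / hardyConst N) with hc
    have hΛ0 : 0 ≤ Λ := principalEigenvalue_nonneg m
    have hB0 : 0 ≤ B := (abs_nonneg _).trans (hB 0)
    have hpos := hardyConst_pos hN
    have hb : ∀ k, energyForm Λ m (ψ k) (ψ k) ≤ c * ∫ x, ‖gradient (f k) x‖ ^ 2 := fun k => by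
      refine (energyForm_self_le hN hΛ0 hm hB (hψ k)).trans ?_
      rw [hc, mul_assoc]
      exact mul_le_mul_of_nonneg_left
        (integral_norm_gradient_powerTest_sq_le hN hg hs1 (hf k) hη hη1 hM) (by positivity)
    have hq0 : ∀ k, 0 ≤ energyForm Λ m (f k) (f k) := fun k => by
      rw [energyForm_self, sub_nonneg]
      exact principalEigenvalue_mul_hardyTerm_le (hf k)
    have hsq : Tendsto (fun k => energyForm Λ m (f k) (ψ k) ^ 2) atTop (𝓝 0) := by
      refine squeeze_zero (fun k => sq_nonneg _) (fun k =>
        (energyForm_sq_le hN hm hB (hf k) (hψ k)).trans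
          (mul_le_mul_of_nonneg_left (hb k) (hq0 k))) ?_
      simpa using hQ.mul (hD.const_mul c)
    have := (Real.continuous_sqrt.tendsto 0).comp hsq
    simp only [Function.comp_def, Real.sqrt_sq_eq_abs, Real.sqrt_zero] at this
    exact (tendsto_zero_iff_abs_tendsto_zero _).2 this
  have hum : AEStronglyMeasurable u volume := hu.memLp.1
  have hgm : AEStronglyMeasurable (fun x => u x * g (u x)) volume :=
    hum.mul (hg.contDiff.continuous.comp_aestronglyMeasurable hum)
  have hud : ∀ k, ∀ x, (f k x * g (f k x) - u x * g (u x)) ^ 2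
      ≤ ((1 + s) * K) ^ 2 * (f k x - u x) ^ 2 := fun k x => by
    rw [← mul_pow, ← sq_abs (f k x * g (f k x) - u x * g (u x)),
      ← sq_abs ((1 + s) * K * (f k x - u x)), abs_mul ((1 + s) * K),
      abs_of_nonneg (a := (1 + s) * K) (by positivity)]
    exact pow_le_pow_left₀ (abs_nonneg _) (hg.abs_mul_sub_mul_le hs0 _ _) 2
  have hdiff : ∀ k, ∀ᵐ x, (f k x * g (f k x) - u x * g (u x)) ^ 2 * ‖gradient η x‖ ^ 2
      ≤ ((1 + s) * K * M) ^ 2 * ((f k x - u x) ^ 2 / ‖x‖ ^ 2) := fun k => by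
    filter_upwards [hne] with x hx
    calc _ ≤ ((1 + s) * K) ^ 2 * (f k x - u x) ^ 2 * (M ^ 2 / ‖x‖ ^ 2) :=
          mul_le_mul (hud k x) (norm_gradient_sq_le_div hM hx) (by positivity) (by positivity)
      _ = _ := by ring
  have hdi : ∀ k, Integrable
      (fun x => (f k x * g (f k x) - u x * g (u x)) ^ 2 * ‖gradient η x‖ ^ 2) := fun k => by
    refine ((hi k).const_mul (((1 + s) * K * M) ^ 2)).mono' ?_ ?_
    · exact ((((hf k).continuous.mul (hg.contDiff.continuous.comp
        (hf k).continuous)).aestronglyMeasurable.sub hgm).pow 2).mul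
        (hη.continuous_gradient.norm.pow 2).aestronglyMeasurable
    · filter_upwards [hdiff k] with x hx
      rwa [Real.norm_eq_abs, abs_of_nonneg (by positivity)]
  have hei : Integrable (fun x => (u x * g (u x)) ^ 2 * ‖gradient η x‖ ^ 2) := by
    refine (((hdi 0).add (integrable_powerCutoff_error hg (hf 0) hη)).const_mul 2).mono'
      ((hgm.pow 2).mul (hη.continuous_gradient.norm.pow 2).aestronglyMeasurable)
      (ae_of_all _ fun x => ?_)
    rw [Real.norm_eq_abs, abs_of_nonneg (by positivity)]
    simp only [Pi.add_apply, ← add_mul, ← mul_assoc]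
    refine mul_le_mul_of_nonneg_right ?_ (by positivity)
    nlinarith [sq_nonneg (u x * g (u x) - 2 * (f 0 x * g (f 0 x)))]
  set d : ℕ → ℝ := fun k => ∫ x, (f k x - u x) ^ 2 / ‖x‖ ^ 2 with hd
  have herr : ∀ k, ∫ x, (f k x * g (f k x)) ^ 2 * ‖gradient η x‖ ^ 2
      ≤ 2 * (((1 + s) * K * M) ^ 2 * d k + A) := fun k => by
    have h1 : ∫ x, (f k x * g (f k x) - u x * g (u x)) ^ 2 * ‖gradient η x‖ ^ 2
        ≤ ((1 + s) * K * M) ^ 2 * d k := by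
      rw [hd, ← integral_const_mul]
      exact integral_mono_ae (hdi k) ((hi k).const_mul _) (hdiff k)
    refine le_trans ?_ (mul_le_mul_of_nonneg_left (add_le_add h1 hA) zero_le_two)
    rw [← integral_add (hdi k) hei, ← integral_const_mul]
    refine integral_mono (integrable_powerCutoff_error hg (hf k) hη)
      (((hdi k).add hei).const_mul 2) fun x => ?_
    simp only [← add_mul, ← mul_assoc]
    refine mul_le_mul_of_nonneg_right ?_ (by positivity)
    nlinarith [sq_nonneg (f k x * g (f k x) - 2 * (u x * g (u x)))]
  set θ := 1 - κ - 4 * s ^ 2 with hθ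
  set c : ℕ → ℝ := fun k => (energyForm Λ m (f k) (ψ k)
    + 6 * (2 * (((1 + s) * K * M) ^ 2 * d k + A))) / θ with hc
  have hck : ∀ k, ∫ x, ‖gradient (fun x => f k x * (g (f k x) * η x)) x‖ ^ 2 ≤ c k := fun k => by
    rw [hc, le_div_iff₀' hsκ]
    have := caccioppoli_powerCutoff hN hm hB hκ hκm hg hs0 hs1 (hf k) hη
    linarith [herr k]
  have hclim : Tendsto c atTop (𝓝 (12 * A / θ)) := by
    have h1 := ((h0.const_mul (((1 + s) * K * M) ^ 2)).add_const A).const_mul 2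
    have h2 := (hE.add (h1.const_mul 6)).div_const θ
    convert h2 using 2
    ring
  have hlim : ∀ᵐ x, Tendsto (fun k => f k x * (g (f k x) * η x)) atTop
      (𝓝 (u x * (g (u x) * η x))) := by
    filter_upwards [hae] with x hx
    exact hx.mul (((hg.contDiff.continuous.tendsto _).comp hx).mul_const _)
  refine (Lp.eLpNorm_lim_le_liminf_eLpNorm (fun k =>
    (isTestFunction_powerCutoff hg (hf k) hη).continuous.aestronglyMeasurable) _ hlim).trans ?_
  have hr : Tendsto (fun k => (C : ENNReal) * ENNReal.ofReal √(c k)) atTop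
      (𝓝 (C * ENNReal.ofReal √(12 * A / θ))) :=
    ENNReal.Tendsto.const_mul ((ENNReal.continuous_ofReal.tendsto _).comp
      ((Real.continuous_sqrt.tendsto _).comp hclim)) (Or.inr ENNReal.coe_ne_top)
  rw [← hr.liminf_eq]
  refine liminf_le_liminf (Eventually.of_forall fun k => ?_)
  refine (hC _ (isTestFunction_powerCutoff hg (hf k) hη)).trans ?_
  gcongr
  exact hck k

/-! ### The truncated powers -/

/-- The bounded weights `((1 + t²) / (1 + ε t²)) ^ (s / 2)`, which increase to `(1 + t²) ^ (s / 2)`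
as `ε → 0`. -/
noncomputable def truncatedPower (s ε t : ℝ) : ℝ := ((1 + t ^ 2) / (1 + ε * t ^ 2)) ^ (s / 2)

theorem isPowerWeight_truncatedPower {s ε : ℝ} (hs : 0 ≤ s) (hε0 : 0 < ε) (hε1 : ε ≤ 1) :
    IsPowerWeight s ((1 / ε) ^ (s / 2)) (truncatedPower s ε) := by
  have hq : ∀ t : ℝ, 0 < 1 + ε * t ^ 2 := fun t => by positivity
  have hp : ∀ t : ℝ, 0 < 1 + t ^ 2 := fun t => by positivity
  have hQ : ∀ t : ℝ, 0 < (1 + t ^ 2) / (1 + ε * t ^ 2) := fun t => div_pos (hp t) (hq t)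
  have hd : ∀ t, t * deriv (truncatedPower s ε) t = s * (truncatedPower s ε t) *
      (t ^ 2 * (1 - ε) / ((1 + t ^ 2) * (1 + ε * t ^ 2))) := fun t => by
    have h1 : HasDerivAt (fun t : ℝ => 1 + t ^ 2) (2 * t) t := by
      simpa using ((hasDerivAt_pow 2 t).const_add 1)
    have h2 : HasDerivAt (fun t : ℝ => 1 + ε * t ^ 2) (ε * (2 * t)) t := by
      simpa using (((hasDerivAt_pow 2 t).const_mul ε).const_add 1)
    have h3 := ((h1.fun_div h2 (hq t).ne').rpow_const (p := s / 2) (Or.inl (hQ t).ne'))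
    have h4 : deriv (truncatedPower s ε) t = _ := h3.deriv
    rw [h4, Real.rpow_sub_one (hQ t).ne', truncatedPower]
    have := (hq t).ne'
    have := (hp t).ne'
    field_simp
    ring
  have hnn : ∀ t, 0 ≤ truncatedPower s ε t := fun t => Real.rpow_nonneg (hQ t).le _
  refine ⟨?_, hnn, fun t => ?_, fun t => ?_, fun t => ?_⟩
  · refine ContDiff.rpow_const_of_ne (ContDiff.div (by fun_prop) (by fun_prop)
      fun t => (hq t).ne') fun t => (hQ t).ne'
  · refine Real.rpow_le_rpow (hQ t).le ?_ (by positivity)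
    rw [div_le_div_iff₀ (hq t) hε0]
    nlinarith
  · rw [hd]
    have : 0 ≤ 1 - ε := by linarith
    have := hnn t
    have := hp t
    have := hq t
    positivity
  · rw [hd]
    have h1 : t ^ 2 * (1 - ε) / ((1 + t ^ 2) * (1 + ε * t ^ 2)) ≤ 1 := by
      rw [div_le_one (mul_pos (hp t) (hq t))]
      nlinarith [sq_nonneg t, mul_nonneg hε0.le (sq_nonneg t),
        mul_nonneg hε0.le (sq_nonneg (t ^ 2))]
    exact mul_le_of_le_one_right (mul_nonneg hs (hnn t)) h1

theorem truncatedPower_le {s ε : ℝ} (hs : 0 ≤ s) (hε : 0 ≤ ε) (t : ℝ) :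
    truncatedPower s ε t ≤ (1 + t ^ 2) ^ (s / 2) := by
  refine Real.rpow_le_rpow (by positivity) ?_ (by positivity)
  refine div_le_self (by positivity) ?_
  have : 0 ≤ ε * t ^ 2 := by positivity
  linarith

theorem tendsto_truncatedPower (s t : ℝ) {ε : ℕ → ℝ} (hε : Tendsto ε atTop (𝓝 0)) :
    Tendsto (fun n => truncatedPower s (ε n) t) atTop (𝓝 ((1 + t ^ 2) ^ (s / 2))) := by
  have h1 : Tendsto (fun n => (1 + t ^ 2) / (1 + ε n * t ^ 2)) atTop (𝓝 (1 + t ^ 2)) := by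
    have h2 : Tendsto (fun n => 1 + ε n * t ^ 2) atTop (𝓝 1) := by
      simpa using (hε.mul_const (t ^ 2)).const_add 1
    simpa [Pi.div_def] using (tendsto_const_nhds (x := 1 + t ^ 2)).div h2 one_ne_zero
  exact h1.rpow_const (Or.inl (by positivity))

theorem sq_mul_truncatedPower_le {s ε p : ℝ} (hs : 0 ≤ s) (hε : 0 ≤ ε) (hp : 2 + 2 * s ≤ p)
    (t : ℝ) : (t * truncatedPower s ε t) ^ 2 ≤ (1 + |t|) ^ p := by
  have h0 : 0 ≤ truncatedPower s ε t := Real.rpow_nonneg (by positivity) _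
  have h1 : 1 ≤ 1 + |t| := by linarith [abs_nonneg t]
  have h2 : truncatedPower s ε t ≤ (1 + |t|) ^ s := by
    refine (truncatedPower_le hs hε t).trans ?_
    calc (1 + t ^ 2) ^ (s / 2) ≤ ((1 + |t|) ^ 2) ^ (s / 2) := by
          refine Real.rpow_le_rpow (by positivity) ?_ (by positivity)
          nlinarith [abs_nonneg t, sq_abs t]
      _ = (1 + |t|) ^ s := by
          rw [← Real.rpow_natCast, ← Real.rpow_mul (by positivity)]
          congr 1
          push_cast
          ring
  calc (t * truncatedPower s ε t) ^ 2 = (|t| * truncatedPower s ε t) ^ 2 := by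
        rw [mul_pow, mul_pow, sq_abs]
    _ ≤ ((1 + |t|) ^ (1 + s)) ^ 2 := by
        rw [Real.rpow_add (by positivity), Real.rpow_one]
        gcongr
        linarith
    _ = (1 + |t|) ^ (2 + 2 * s) := by
        rw [← Real.rpow_natCast, ← Real.rpow_mul (by positivity)]
        congr 1
        push_cast
        ring
    _ ≤ (1 + |t|) ^ p := Real.rpow_le_rpow_of_exponent_le h1 hp

/-! ### Higher integrability near the origin -/

theorem exists_abs_le_of_tendsto_cocompact {X : Type*} [TopologicalSpace X] {m : X → ℝ} {a : ℝ}
    (hm : Continuous m) (hlim : Tendsto m (cocompact X) (𝓝 a)) : ∃ B, ∀ x, |m x| ≤ B := by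
  have h1 : ∀ᶠ x in cocompact X, |m x| < |a| + 1 :=
    hlim.abs.eventually_lt_const (lt_add_one _)
  obtain ⟨K, hK, hKs⟩ := mem_cocompact.1 h1
  obtain ⟨B, hB⟩ := hK.exists_bound_of_continuousOn hm.continuousOn
  refine ⟨max B (|a| + 1), fun x => ?_⟩
  by_cases hx : x ∈ K
  · exact (hB x hx).trans (le_max_left _ _)
  · exact (le_of_lt (hKs hx)).trans (le_max_right _ _)

/-- If the potential `Λ m / |x|²` is subcritical on the support of the cutoff `η`, then
`η u (1 + u²) ^ (s / 2)` belongs to `L^{2*}` for small `s > 0`. -/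
theorem memLp_mul_one_add_sq_rpow {N : ℕ} (hN : 3 ≤ N) {s B κ : ℝ}
    {m u η : EuclideanSpace ℝ (Fin N) → ℝ}
    {G : EuclideanSpace ℝ (Fin N) → EuclideanSpace ℝ (Fin N)}
    (hm : Continuous m) (hB : ∀ x, |m x| ≤ B) (hκ : 0 ≤ κ)
    (hκm : ∀ x, η x ≠ 0 → principalEigenvalue m * m x ≤ κ * hardyConst N)
    (hu : HasD12Gradient u G)
    (hmin : ∫ x, ‖G x‖ ^ 2 = principalEigenvalue m * hardyTerm m u)
    (hs0 : 0 ≤ s) (hs1 : s ≤ 1) (hsκ : 0 < 1 - κ - 4 * s ^ 2) (hsp : 2 + 2 * s ≤ sobolevExp N)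
    (hη : IsTestFunction η) (hη1 : ∀ x, |η x| ≤ 1) :
    MemLp (fun x => u x * ((1 + u x ^ 2) ^ (s / 2) * η x)) (ENNReal.ofReal (sobolevExp N))
      volume := by
  obtain ⟨C, hC⟩ := exists_sobolev_const hN
  have hp0 : 0 < sobolevExp N := by linarith
  have hum : AEStronglyMeasurable u volume := hu.memLp.1
  set ε : ℕ → ℝ := fun n => 1 / ((n : ℝ) + 1) with hε
  have hεp : ∀ n, 0 < ε n := fun n => by simp only [hε]; positivity
  have hε1 : ∀ n, ε n ≤ 1 := fun n => by
    simp only [hε]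
    rw [div_le_one (by positivity)]
    have : (0 : ℝ) ≤ n := Nat.cast_nonneg n
    linarith
  have hε0 : Tendsto ε atTop (𝓝 0) := tendsto_one_div_add_atTop_nhds_zero_nat
  -- `∇η` has compact support and `u ∈ L^{2*}`, so the error terms have a common majorant
  have hint : Integrable (fun x => (1 + |u x|) ^ sobolevExp N * ‖gradient η x‖ ^ 2) := by
    set S := tsupport (gradient η) with hS
    have hSc : IsCompact S := hη.hasCompactSupport_gradient
    have hfin : IsFiniteMeasure (volume.restrict S) :=
      isFiniteMeasure_restrict.2 hSc.measure_lt_top.ne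
    have h1 : MemLp (fun x => 1 + |u x|) (ENNReal.ofReal (sobolevExp N)) (volume.restrict S) :=
      (memLp_const (1 : ℝ)).add (hu.memLp.restrict S).norm
    have h2 := h1.integrable_norm_rpow (ENNReal.ofReal_pos.2 hp0).ne' ENNReal.ofReal_ne_top
    rw [ENNReal.toReal_ofReal hp0.le] at h2
    have h3 : IntegrableOn (fun x => (1 + |u x|) ^ sobolevExp N) S := by
      refine h2.congr (ae_of_all _ fun x => ?_)
      simp only [Real.norm_eq_abs]
      rw [abs_of_nonneg (a := 1 + |u x|) (by positivity)]
    obtain ⟨L, hL⟩ := hη.continuous_gradient.bounded_above_of_compact_support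
      hη.hasCompactSupport_gradient
    have h4 : IntegrableOn (fun x => (1 + |u x|) ^ sobolevExp N * ‖gradient η x‖ ^ 2) S := by
      refine Integrable.mul_bdd (c := L ^ 2) h3
        (hη.continuous_gradient.norm.pow 2).aestronglyMeasurable (ae_of_all _ fun x => ?_)
      rw [norm_pow, norm_norm]
      exact pow_le_pow_left₀ (norm_nonneg _) (hL x) 2
    refine (integrableOn_iff_integrable_of_support_subset fun x hx => ?_).1 h4
    refine subset_tsupport _ fun h0 => hx ?_
    simp [h0]
  set A := ∫ x, (1 + |u x|) ^ sobolevExp N * ‖gradient η x‖ ^ 2 with hA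
  have hbound : ∀ n, eLpNorm (fun x => u x * (truncatedPower s (ε n) (u x) * η x))
      (ENNReal.ofReal (sobolevExp N)) volume
        ≤ C * ENNReal.ofReal √(12 * A / (1 - κ - 4 * s ^ 2)) := fun n => by
    refine eLpNorm_powerCutoff_le hN hm hB hκ hκm hu hmin
      (isPowerWeight_truncatedPower hs0 (hεp n) (hε1 n)) hs0 hs1 hsκ hη hη1 hC ?_
    refine integral_mono_of_nonneg (ae_of_all _ fun x => by positivity) hint
      (ae_of_all _ fun x => ?_)
    exact mul_le_mul_of_nonneg_right (sq_mul_truncatedPower_le hs0 (hεp n).le hsp (u x))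
      (by positivity)
  have hmeas : ∀ n, AEStronglyMeasurable (fun x => u x * (truncatedPower s (ε n) (u x) * η x))
      volume := fun n =>
    hum.mul (((isPowerWeight_truncatedPower hs0 (hεp n)
      (hε1 n)).contDiff.continuous.comp_aestronglyMeasurable hum).mul
        hη.continuous.aestronglyMeasurable)
  have hlim : ∀ᵐ x, Tendsto (fun n => u x * (truncatedPower s (ε n) (u x) * η x)) atTop
      (𝓝 (u x * ((1 + u x ^ 2) ^ (s / 2) * η x))) := ae_of_all _ fun x =>
    ((tendsto_truncatedPower s (u x) hε0).mul_const _).const_mul _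
  refine ⟨aestronglyMeasurable_of_tendsto_ae atTop hmeas hlim, ?_⟩
  refine (Lp.eLpNorm_lim_le_liminf_eLpNorm hmeas _ hlim).trans_lt ?_
  exact ((liminf_le_liminf (Eventually.of_forall hbound)).trans_eq (liminf_const _)).trans_lt
    (ENNReal.mul_lt_top ENNReal.coe_lt_top ENNReal.ofReal_lt_top)

theorem mainTheorem8 (N : ℕ) (hN : 3 ≤ N) (m : EuclideanSpace ℝ (Fin N) → ℝ)
    (hm : Continuous m) (mInf : ℝ)
    (hlim : Tendsto m (cocompact (EuclideanSpace ℝ (Fin N))) (𝓝 mInf))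
    (h0 : 0 < m 0) (hInf : 0 < mInf)
    (hΛ : principalEigenvalue m < hardyConst N * min (1 / m 0) (1 / mInf))
    (φ : EuclideanSpace ℝ (Fin N) → ℝ) (hφ : IsGroundState m φ)
    (hpos : ∀ᵐ x, 0 < φ x) :
    ∃ δ : ℝ, 0 < δ ∧ ∃ r : ℝ, 0 < r ∧
      MemLp φ (ENNReal.ofReal (sobolevExp N * (1 + δ)))
        (volume.restrict (Metric.ball (0 : EuclideanSpace ℝ (Fin N)) r)) := by
  obtain ⟨G, hG, hH, hmin⟩ := hφ
  rw [div_eq_iff hH.ne'] at hmin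
  obtain ⟨B, hB⟩ := exists_abs_le_of_tendsto_cocompact hm hlim
  have hc := hardyConst_pos hN
  have hN' : (3 : ℝ) ≤ N := by exact_mod_cast hN
  have hp : 2 < sobolevExp N := by
    rw [sobolevExp, lt_div_iff₀ (by linarith)]
    linarith
  set Λ := principalEigenvalue m with hΛd
  have hΛ0 : 0 ≤ Λ := principalEigenvalue_nonneg m
  have hsub : Λ * m 0 < hardyConst N := by
    have : Λ < hardyConst N * (1 / m 0) :=
      hΛ.trans_le (mul_le_mul_of_nonneg_left (min_le_left _ _) hc.le)
    rwa [mul_one_div, lt_div_iff₀ h0] at this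
  -- `κ` lies strictly between `Λ m(0) / Λ_N` and `1`
  set κ : ℝ := (1 + Λ * m 0 / hardyConst N) / 2 with hκ
  have hq1 : Λ * m 0 / hardyConst N < 1 := (div_lt_one hc).2 hsub
  have hq0 : 0 ≤ Λ * m 0 / hardyConst N := by positivity
  have hκ1 : κ < 1 := by rw [hκ]; linarith
  have hκ0 : 0 ≤ κ := by rw [hκ]; linarith
  have hκ2 : Λ * m 0 < κ * hardyConst N := by
    rw [← div_lt_iff₀ hc, hκ]
    linarith
  obtain ⟨R, hR, hRm⟩ := Metric.eventually_nhds_iff_ball.1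
    (((continuous_const.mul hm).tendsto 0).eventually_lt_const hκ2)
  set s : ℝ := min ((1 - κ) / 8) ((sobolevExp N - 2) / 2) with hs
  have hs0 : 0 < s := lt_min (by linarith) (by linarith)
  have hs1 : s ≤ (1 - κ) / 8 := min_le_left _ _
  have hs2 : s ≤ (sobolevExp N - 2) / 2 := min_le_right _ _
  let η : ContDiffBump (0 : EuclideanSpace ℝ (Fin N)) := ⟨R / 2, R, by linarith, by linarith⟩
  have hη : IsTestFunction η := ⟨η.contDiff, η.hasCompactSupport⟩
  have hmem := memLp_mul_one_add_sq_rpow hN (s := s) hm hB hκ0 (fun x hx => (hRm x (by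
      have : x ∈ Function.support η := hx
      rwa [η.support_eq] at this)).le) hG hmin hs0.le (by linarith) (by nlinarith) (by linarith) hη
    (fun x => by rw [abs_of_nonneg η.nonneg]; exact η.le_one)
  have hφm : AEStronglyMeasurable φ (volume.restrict (Metric.ball 0 (R / 2))) :=
    hG.memLp.1.restrict
  refine ⟨s, hs0, R / 2, by linarith, hφm, ?_⟩
  have hpow : eLpNorm (fun x => ‖φ x‖ ^ (1 + s)) (ENNReal.ofReal (sobolevExp N))
      (volume.restrict (Metric.ball 0 (R / 2))) < ⊤ := by
    refine lt_of_le_of_lt (eLpNorm_mono_ae ?_) (hmem.restrict _).2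
    filter_upwards [ae_restrict_mem measurableSet_ball] with x hx
    have hx1 : η x = 1 := η.one_of_mem_closedBall (Metric.ball_subset_closedBall hx)
    have h1 : |φ x| ^ s ≤ (1 + φ x ^ 2) ^ (s / 2) := by
      calc |φ x| ^ s = (|φ x| ^ 2) ^ (s / 2) := by
            rw [← Real.rpow_natCast, ← Real.rpow_mul (abs_nonneg _)]
            congr 1
            push_cast
            ring
        _ ≤ (1 + φ x ^ 2) ^ (s / 2) := by
            rw [sq_abs]
            exact Real.rpow_le_rpow (by positivity) (by linarith) (by positivity)
    simp only [hx1, mul_one, norm_mul, Real.norm_eq_abs]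
    rw [abs_of_nonneg (a := |φ x| ^ (1 + s)) (by positivity),
      abs_of_nonneg (a := (1 + φ x ^ 2) ^ (s / 2)) (by positivity),
      Real.rpow_add_of_nonneg (abs_nonneg _) zero_le_one hs0.le, Real.rpow_one]
    exact mul_le_mul_of_nonneg_left h1 (abs_nonneg _)
  rw [eLpNorm_norm_rpow _ (by linarith), ← ENNReal.ofReal_mul (by linarith)] at hpow
  exact (ENNReal.rpow_lt_top_iff_of_pos (by linarith)).1 hpow
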